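/- \textbf{Setting.} All manifolds and maps are $C^\infty$. Let $Q$ be a $d$-dimensional manifold, $k\ge 0$ an integer, and $M=(T^1_k)^*Q=T^*Q\oplus\overset{k}{\cdots}\oplus T^*Q$, with projection $\tau^*\colon M\to Q$ and natural coordinates $(q^i,p^A_i)$. Let $\theta^A$ be the pull-back to $M$ of the Liouville $1$-form of the $A$-th copy of $T^*Q$ (locally $\theta^A=p^A_i\,dq^i$) and $\omega^A=-d\theta^A$. Let $H\colon M\to\mathbb R$ be smooth. A solution of the Hamilton--de Donder--Weyl (HDW) equations is a smooth map $\psi=(\psi^i,\psi^A_i)\colon D\to M$, $D\subseteq\mathbb R^k$ open, with $$\frac{\partial H}{\partial q^i}\Big|_{\psi(t)}=-\sum_{A=1}^k\frac{\partial\psi^A_i}{\partial t^A}\Big|_t,\qquad \frac{\partial H}{\partial p^A_i}\Big|_{\psi(t)}=\frac{\partial\psi^i}{\partial t^A}\Big|_t\qquad(t\in D).$$ It is admissible if its image is an embedded submanifold of $M$; the system $(M,\omega^A,H)$ is called admissible when only admissible solutions are considered. A vector field $Y$ on $M$ is an infinitesimal symmetry of the admissible system if each map $F_s$ of each of its local flows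 is a local symmetry, that is, carries admissible solutions lying in the domain of the flow to admissible solutions. A $k$-vector field $\mathbf X=(X_1,\dots,X_k)$ on $M$ is integrable if through every point $x\in M$ there is an integral section, i.e. a map $\psi\colon D\to M$, $0\in D\subseteq\mathbb R^k$ open, with $\psi(0)=x$ and $\partial\psi/\partial t^A=X_A\circ\psi$ for all $A$; $\mathfrak X^k_H(M)$ is the set of $k$-vector fields with $\sum_{A=1}^k i(X_A)\omega^A=dH$. Let $n\ge 1$. A vector field $Y$ on $M$ is an infinitesimal Cartan (Noether) symmetry of order $n$ if it is an infinitesimal symmetry, $L(Y)^n\omega^A=0$ for all $A$ while for each $m<n$ the forms $L(Y)^m\omega^1,\dots,L(Y)^m\omega^k$ are not all zero, and $L(Y)H=0$. \textbf{Theorem (Noether).} Let $Y$ be an infinitesimal Cartan (Noether) symmetry of order $n$ of the admissible $k$-symplectic Hamiltonian system $(M,\omega^A,H)$. Every $p\in M$ has an open neighbourhood $U_p$ on which there are smooth functions $\xi^1,\dots,\xi^k$ with $L(Y)^n\theta^A=d\xi^A$. For every open set $U\subseteq M$ and all smooth functions $\xi^A$ on $U$ with $L(Y)^n\theta^A=d\xi^A$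 on $U$, the functions $$g^A=L(Y)^{n-1}\big(i(Y)\theta^A\big)-\xi^A\qquad(A=1,\dots,k)$$ satisfy $dg^A=L(Y)^{n-1}i(Y)\omega^A$ on $U$, and $g=(g^1,\dots,g^k)\colon U\to\mathbb R^k$ is a conserved quantity: $\sum_{A=1}^k\partial(g^A\circ\psi)/\partial t^A=0$ for every admissible solution $\psi$ of the HDW equations with values in $U$, and, for every integrable $k$-vector field $\mathbf X=(X_1,\dots,X_k)\in\mathfrak X^k_H(M)$, $$\sum_{A=1}^k L(X_A)g^A=0\quad\text{on }U.$$ -/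

import Mathlib

open Set Filter
open scoped Manifold ContDiff Topology Bundle

namespace KSymplectic

noncomputable section

/-! ### Cartan calculus on a manifold without boundary -/

section Calculus

variable {E : Type*} [NormedAddCommGroup E] [NormedSpace ℝ E] {H : Type*} [TopologicalSpace H]
  (I : ModelWithCorners ℝ E H) {M : Type*} [TopologicalSpace M] [ChartedSpace H M]

/-- Vector fields on `M`; smoothness is the separate predicate `IsSmoothVF`. -/
abbrev VF (M : Type*) [TopologicalSpace M] [ChartedSpace H M] : Type _ :=
  (x : M) → TangentSpace I x

/-- `Y ∈ 𝔛(M)`: the vector field is of class `C^∞`. -/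
def IsSmoothVF [IsManifold I 1 M] (Y : VF I M) : Prop :=
  ContMDiff I I.tangent ∞ (fun x => (⟨x, Y x⟩ : TangentBundle I M))

/-- Fields of alternating `p`-linear forms on the tangent spaces of `M`. -/
abbrev Form (p : ℕ) (M : Type*) [TopologicalSpace M] [ChartedSpace H M] : Type _ :=
  (x : M) → TangentSpace I x [⋀^Fin p]→L[ℝ] ℝ

/-- The expression of `α` in the chart at `x₀`: its pull-back by the inverse of the chart. -/
def Form.inChart {p : ℕ} (α : Form I p M) (x₀ : M) : E → E [⋀^Fin p]→L[ℝ] ℝ := fun y =>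
  (α ((extChartAt I x₀).symm y)).compContinuousLinearMap
    (mfderiv 𝓘(ℝ, E) I (extChartAt I x₀).symm y)

/-- Exterior derivative: at `x` it is the pull-back by the chart at `x` of the exterior derivative,
in the model vector space, of the expression of the form in that chart. -/
def extD {p : ℕ} (α : Form I p M) : Form I (p + 1) M := fun x =>
  (extDeriv (Form.inChart I α x) (extChartAt I x x)).compContinuousLinearMap
    (mfderiv I 𝓘(ℝ, E) (extChartAt I x) x)

/-- A field of covectors regarded as a `1`-form. -/
def oneForm (a : (x : M) → TangentSpace I x →L[ℝ] ℝ) : Form I 1 M := fun x =>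
  ContinuousAlternatingMap.ofSubsingleton ℝ (TangentSpace I x) ℝ (0 : Fin 1) (a x)

/-- The differential `df` of a function. -/
def dFun (f : M → ℝ) : Form I 1 M := oneForm I fun x => mfderiv I 𝓘(ℝ, ℝ) f x

/-- Interior product `i(Y)α = α(Y, ·, …, ·)`. -/
def interior {p : ℕ} (Y : VF I M) (α : Form I (p + 1) M) : Form I p M := fun x =>
  ContinuousAlternatingMap.curryLeft (E := E) (α x) (Y x)

/-- The Lie derivative `L(Y)f = df(Y)` of a function. -/
def lieFun (Y : VF I M) (f : M → ℝ) : M → ℝ := fun x => mfderiv I 𝓘(ℝ, ℝ) f x (Y x)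

/-- The Lie derivative `L(Y)α = d i(Y)α + i(Y) dα` of a form of positive degree. -/
def lieForm {p : ℕ} (Y : VF I M) (α : Form I (p + 1) M) : Form I (p + 1) M :=
  extD I (interior I Y α) + interior I Y (extD I α)

/-- The function `i(Y)α` for a `1`-form `α`. -/
def contract (Y : VF I M) (α : Form I 1 M) : M → ℝ := fun x => α x ![Y x]

/-- A (local) flow of `Y` on the set `V` for times `|s| < ε`: the curve `s ↦ F s x` is the integral
curve of `Y` starting at `x`, for every `x ∈ V`. -/
def IsLocalFlow (Y : VF I M) (V : Set M) (ε : ℝ) (F : ℝ → M → M) : Prop :=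
  IsOpen V ∧ 0 < ε ∧
    ∀ x ∈ V, F 0 x = x ∧ IsMIntegralCurveOn (I := I) (fun s => F s x) Y (Ioo (-ε) ε)

/-- `S` is an embedded submanifold of `M`: for some dimension `r`, around each point of `S` there is
a chart of `M` in which `S` is an `r`-dimensional linear slice. -/
def IsEmbeddedSubmanifold (S : Set M) : Prop :=
  ∃ r : ℕ, ∀ x ∈ S, ∃ (Φ : OpenPartialHomeomorph M E) (W : Submodule ℝ E),
    x ∈ Φ.source ∧ ContMDiffOn I 𝓘(ℝ, E) ∞ Φ Φ.source ∧
    ContMDiffOn 𝓘(ℝ, E) I ∞ Φ.symm Φ.target ∧ Module.finrank ℝ W = r ∧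
    ∀ᶠ y in 𝓝 x, (y ∈ S ↔ Φ y ∈ W)

/-- The partial derivative `ψ_*(t)(∂/∂t^A)` of a map `ψ` from `ℝ^k` to `M`. -/
def partialD {k : ℕ} (ψ : (Fin k → ℝ) → M) (t : Fin k → ℝ) (A : Fin k) :
    TangentSpace I (ψ t) :=
  mfderiv 𝓘(ℝ, Fin k → ℝ) I ψ t (Pi.single A (1 : ℝ) : Fin k → ℝ)

/-- `ψ`, defined on the open set `D ⊆ ℝ^k` with `0 ∈ D`, is an integral section at `x` of the
`k`-vector field `X = (X_1, …, X_k)`. -/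
def IsIntegralSection {k : ℕ} (X : Fin k → VF I M) (x : M) (D : Set (Fin k → ℝ))
    (ψ : (Fin k → ℝ) → M) : Prop :=
  IsOpen D ∧ (0 : Fin k → ℝ) ∈ D ∧ ψ 0 = x ∧ ContMDiffOn 𝓘(ℝ, Fin k → ℝ) I ∞ ψ D ∧
    ∀ t ∈ D, ∀ A, partialD I ψ t A = X A (ψ t)

/-- A `k`-vector field is integrable if it has an integral section at every point. -/
def IsIntegrable {k : ℕ} (X : Fin k → VF I M) : Prop :=
  ∀ x, ∃ D ψ, IsIntegralSection I X x D ψ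

end Calculus

/-! ### The bundle of `k^1`-covelocities and its canonical `k`-symplectic structure -/

section Covelocities

variable (d k : ℕ) (Q : Type*) [TopologicalSpace Q] [ChartedSpace (EuclideanSpace ℝ (Fin d)) Q]

/-- The model space `ℝ^d` of the base manifold `Q`. -/
abbrev BaseE : Type := EuclideanSpace ℝ (Fin d)

/-- The model fibre `(ℝ^d)^* ⊕ ⋯ ⊕ (ℝ^d)^*` (`k` copies), as the linear maps `ℝ^d → ℝ^k`. -/
abbrev FibE : Type := EuclideanSpace ℝ (Fin d) →L[ℝ] (Fin k → ℝ)

variable [IsManifold (𝓡 d) ∞ Q]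

/-- `(T^1_k)^*Q = T^*Q ⊕ ⋯ ⊕ T^*Q` (`k` copies). A point over `q` is a linear map
`α : T_qQ → ℝ^k`, that is, the `k`-tuple of covectors `v ↦ α v A`, `A = 1, …, k`.
It carries Mathlib's structure of smooth vector bundle, hence of smooth manifold. -/
abbrev Cov : Type _ :=
  Bundle.TotalSpace (FibE d k)
    (fun q : Q => TangentSpace (𝓡 d) q →L[ℝ] Bundle.Trivial Q (Fin k → ℝ) q)

/-- The model with corners of `(T^1_k)^*Q`. -/
abbrev covI : ModelWithCorners ℝ (BaseE d × FibE d k) (ModelProd (BaseE d) (FibE d k)) :=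
  (𝓡 d).prod 𝓘(ℝ, FibE d k)

variable {Q}

/-- The canonical `1`-form `θ^A`, pull-back of the Liouville form of `T^*Q` by the projection onto
the `A`-th copy: `θ^A_{(α_1, …, α_k)}(v) = α_A(τ^*_* v)`. -/
def theta (A : Fin k) : Form (covI d k) 1 (Cov d k Q) :=
  oneForm (covI d k) fun x =>
    ((ContinuousLinearMap.proj A : (Fin k → ℝ) →L[ℝ] ℝ).comp
      (x.2 : TangentSpace (𝓡 d) x.proj →L[ℝ] (Fin k → ℝ))).comp
      (mfderiv (covI d k) (𝓡 d)
        (Bundle.TotalSpace.proj : Cov d k Q → Q) x)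

/-- The canonical `2`-form `ω^A = -dθ^A`. -/
def omega (A : Fin k) : Form (covI d k) 2 (Cov d k Q) :=
  fun x => -extD (covI d k) (theta d k A) x

/-- The `k`-vector fields `X ∈ 𝔛^k_H((T^1_k)^*Q)`: smooth solutions of `∑_A i(X_A)ω^A = dH`. -/
def IsHamiltonianKVF (Ham : Cov d k Q → ℝ) (X : Fin k → VF (covI d k) (Cov d k Q)) : Prop :=
  (∀ A, IsSmoothVF (covI d k) (X A)) ∧
    ∑ A, interior (covI d k) (X A) (omega d k A) = dFun (covI d k) Ham

/-- The smooth map `ψ : D → (T^1_k)^*Q`, `D ⊆ ℝ^k` open, is a solution on `D` of the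
Hamilton-de Donder-Weyl equations
`∂H/∂q^i = -∑_A ∂ψ^A_i/∂t^A` and `∂H/∂p^A_i = ∂ψ^i/∂t^A`.
They are written at `t` in the natural coordinates `(q^i, p^A_i)` around `ψ t`, given by
`extChartAt`: the coordinates of `(y, p) : ℝ^d × (ℝ^d → ℝ^k)` are `q^i = y i`, `p^A_i = p e_i A`. -/
def IsHDWSolution (Ham : Cov d k Q → ℝ) (D : Set (Fin k → ℝ)) (ψ : (Fin k → ℝ) → Cov d k Q) :
    Prop :=
  IsOpen D ∧ ContMDiffOn 𝓘(ℝ, Fin k → ℝ) (covI d k) ∞ ψ D ∧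
    ∀ t ∈ D,
      let c := extChartAt (covI d k) (ψ t)
      let dH : BaseE d × FibE d k →L[ℝ] ℝ := fderiv ℝ (Ham ∘ c.symm) (c (ψ t))
      let dψ : (Fin k → ℝ) →L[ℝ] BaseE d × FibE d k := fderiv ℝ (c ∘ ψ) t
      (∀ i : Fin d, dH (EuclideanSpace.single i 1, 0) =
        -∑ A, (dψ (Pi.single A 1)).2 (EuclideanSpace.single i 1) A) ∧
      (∀ (A : Fin k) (i : Fin d),
        dH (0, (EuclideanSpace.proj i : BaseE d →L[ℝ] ℝ).smulRight (Pi.single A 1)) =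
          (dψ (Pi.single A 1)).1 i)

/-- Admissible solutions: the image is an embedded submanifold of `(T^1_k)^*Q`. -/
def IsAdmissibleSolution (Ham : Cov d k Q → ℝ) (D : Set (Fin k → ℝ))
    (ψ : (Fin k → ℝ) → Cov d k Q) : Prop :=
  IsHDWSolution d k Ham D ψ ∧ IsEmbeddedSubmanifold (covI d k) (ψ '' D)

/-- Infinitesimal symmetries of the admissible system: smooth vector fields whose local flows are
local symmetries, i.e. carry admissible solutions (lying in the domain of the flow) to
admissible solutions. -/
def IsInfinitesimalSymmetry (Ham : Cov d k Q → ℝ) (Y : VF (covI d k) (Cov d k Q)) : Prop :=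
  IsSmoothVF (covI d k) Y ∧
    ∀ V ε F, IsLocalFlow (covI d k) Y V ε F → ∀ s ∈ Ioo (-ε) ε,
      ∀ D ψ, IsAdmissibleSolution d k Ham D ψ → MapsTo ψ D V →
        IsAdmissibleSolution d k Ham D (F s ∘ ψ)

/-- Infinitesimal Cartan (Noether) symmetries of order `n`. -/
structure IsCartanSymmetry (Ham : Cov d k Q → ℝ) (n : ℕ) (Y : VF (covI d k) (Cov d k Q)) :
    Prop where
  order_pos : 1 ≤ n
  symmetry : IsInfinitesimalSymmetry d k Ham Y
  lie_omega : ∀ A, (lieForm (covI d k) Y)^[n] (omega d k A) = 0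
  lie_omega_ne : ∀ m < n, ∃ A, (lieForm (covI d k) Y)^[m] (omega d k A) ≠ 0
  lie_ham : lieFun (covI d k) Y Ham = 0

/-- The smooth map `g = (g^1, …, g^k) : U → ℝ^k` is a conservation law of the admissible system:
`g ∘ ψ` is divergence free for every admissible solution `ψ` lying in the open set `U`. -/
def IsConservationLawOn (Ham : Cov d k Q → ℝ) (U : Set (Cov d k Q))
    (g : Fin k → Cov d k Q → ℝ) : Prop :=
  (∀ A, ContMDiffOn (covI d k) 𝓘(ℝ, ℝ) ∞ (g A) U) ∧
    ∀ D ψ, IsAdmissibleSolution d k Ham D ψ → MapsTo ψ D U →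
      ∀ t ∈ D, ∑ A, fderiv ℝ (g A ∘ ψ) t (Pi.single A 1) = 0

end Covelocities

end

end KSymplectic

namespace KSymplectic

/-! ### Local flows of C² vector fields and the equation of variations -/

section Flow

variable {E : Type*} [NormedAddCommGroup E] [NormedSpace ℝ E]

/-! The HDW equations say that `∑_A i(∂_A ψ) ω^A = dH` along `ψ` (`isHDWSolution_iff`). Inserting
`Y` and using `L(Y)H = 0` gives `∑_A (i(Y)ω^A)(∂_A φ) = 0` along every solution `φ`. If the flow
`F_s` of `Y` carries `ψ` to solutions, the case `φ = F_s ∘ ψ` reads `∑_A (F_s^* i(Y)ω^A)(∂_A ψ) = 0`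
for all small `s`, and differentiating `m` times at `s = 0` gives `∑_A (L(Y)^m i(Y)ω^A)(∂_A ψ) = 0`.
For `m = n - 1` the forms are the `dg^A`, so this is the vanishing of the divergence.

The obstacle is that the symmetry hypothesis applies only to solutions with embedded image lying in
the domain of the flow, and a restriction of an admissible solution, or an integral section, need
not have embedded image. At a point where the rank of `ψ` is locally maximal, the constant rank
theorem makes the images of suitable small neighbourhoods embedded
(`exists_isEmbeddedSubmanifold_image`), so the argument applies there
(`exists_sum_iterate_lieForm_partialD_eq_zero`). Every nonempty open set of parameters contains such
a point, and the divergence is continuous, so it vanishes everywhere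
(`IsHDWSolution.sum_fderiv_comp_eq_zero`). This covers all HDW solutions, in particular the integral
sections of `X`, which yields `∑_A L(X_A)g^A = 0`.

The derivative in `s` is taken in a chart: `F_s` transports vectors by the equation of variations
(`exists_localFlow_hasDerivAt_variation`), and along such vectors the derivative of a 1-form is its
Lie derivative (`sum_inChart_iterate_lieForm_eq_zero`).

The remaining claims are Cartan calculus. Since `d` commutes with `L(Y)`, the form `L(Y)^n θ^A` is
closed, hence locally exact. Cartan's formula gives `i(Y)ω^A = d(i(Y)θ^A) - L(Y)θ^A`; applying
`L(Y)^{n-1}` yields the formula for `dg^A` (`iterate_lieForm_interior_omega`). -/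

lemma gronwallBound_le_mul_exp {δ K ε x : ℝ} (hK : 1 ≤ K) (hε : 0 ≤ ε) (hx : 0 ≤ x) :
    gronwallBound δ K ε x ≤ (δ + ε) * Real.exp (K * x) := by
  have hK0 : K ≠ 0 := by positivity
  rw [gronwallBound_of_K_ne_0 hK0]
  have h1 : ε / K ≤ ε := div_le_self hε hK
  have h2 : 0 ≤ Real.exp (K * x) - 1 := by
    have : 0 ≤ K * x := by positivity
    linarith [Real.one_le_exp this]
  nlinarith [mul_le_mul_of_nonneg_right h1 h2]

/-- Grönwall comparison, forward and backward in time, of a trajectory of `f` with an approximate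
trajectory. -/
lemma norm_sub_le_of_approx_trajectory {f : E → E} {S : Set E} {K : NNReal} (hK : 1 ≤ K)
    (hf : LipschitzOnWith K f S) {u w w' : ℝ → E} {b η : ℝ} (hη : 0 ≤ η)
    (hu : ∀ s ∈ Ioo (-b) b, HasDerivAt u (f (u s)) s) (huS : ∀ s ∈ Ioo (-b) b, u s ∈ S)
    (hw : ∀ s ∈ Ioo (-b) b, HasDerivAt w (w' s) s) (hwS : ∀ s ∈ Ioo (-b) b, w s ∈ S)
    (hw' : ∀ s ∈ Ioo (-b) b, ‖w' s - f (w s)‖ ≤ η) {s : ℝ} (hs : s ∈ Ioo (-b) b) :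
    ‖u s - w s‖ ≤ (‖u 0 - w 0‖ + η) * Real.exp (K * |s|) := by
  rcases le_total 0 s with h0 | h0
  · have hI : Icc 0 s ⊆ Ioo (-b) b := fun t ht =>
      ⟨by linarith [ht.1, hs.2], lt_of_le_of_lt ht.2 hs.2⟩
    have key := dist_le_of_approx_trajectories_ODE_of_mem (v := fun _ => f) (s := fun _ => S)
      (K := K) (f := u) (g := w) (f' := fun s => f (u s)) (g' := w') (a := 0) (b := s) (εf := 0)
      (εg := η) (δ := ‖u 0 - w 0‖) (fun _ _ => hf)
      (fun t ht => (hu t (hI ht)).continuousAt.continuousWithinAt)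
      (fun t ht => (hu t (hI (Ico_subset_Icc_self ht))).hasDerivWithinAt)
      (fun t ht => by simp)
      (fun t ht => huS t (hI (Ico_subset_Icc_self ht)))
      (fun t ht => (hw t (hI ht)).continuousAt.continuousWithinAt)
      (fun t ht => (hw t (hI (Ico_subset_Icc_self ht))).hasDerivWithinAt)
      (fun t ht => by rw [dist_eq_norm]; exact hw' t (hI (Ico_subset_Icc_self ht)))
      (fun t ht => hwS t (hI (Ico_subset_Icc_self ht)))
      (by rw [dist_eq_norm]) s (right_mem_Icc.2 h0)
    rw [dist_eq_norm, zero_add, sub_zero] at key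
    rw [abs_of_nonneg h0]
    exact key.trans (gronwallBound_le_mul_exp (by exact_mod_cast hK) hη h0)
  -- Backward in time, `t ↦ u (-t)` is a trajectory of `-f`, which has the same Lipschitz constant.
  · have h0' : 0 ≤ -s := by linarith
    have hI : ∀ t ∈ Icc 0 (-s), -t ∈ Ioo (-b) b := fun t ht =>
      ⟨by linarith [ht.2, hs.1], by linarith [ht.1, ht.2, hs.1, hs.2]⟩
    have hneg : ∀ t : ℝ, HasDerivAt (fun t : ℝ => -t) (-1) t := fun t => (hasDerivAt_id t).neg
    have du : ∀ t ∈ Icc 0 (-s), HasDerivAt (fun t => u (-t)) (-f (u (-t))) t := fun t ht => by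
      simpa [Function.comp_def] using (hu (-t) (hI t ht)).scomp t (hneg t)
    have dw : ∀ t ∈ Icc 0 (-s), HasDerivAt (fun t => w (-t)) (-w' (-t)) t := fun t ht => by
      simpa [Function.comp_def] using (hw (-t) (hI t ht)).scomp t (hneg t)
    have key := dist_le_of_approx_trajectories_ODE_of_mem (v := fun _ x => -f x) (s := fun _ => S)
      (K := K) (f := fun t => u (-t)) (g := fun t => w (-t)) (f' := fun t => -f (u (-t)))
      (g' := fun t => -w' (-t)) (a := 0) (b := -s) (εf := 0)
      (εg := η) (δ := ‖u 0 - w 0‖) (fun _ _ => by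
        intro x hx y hy
        simpa using hf hx hy)
      (fun t ht => (du t ht).continuousAt.continuousWithinAt)
      (fun t ht => (du t (Ico_subset_Icc_self ht)).hasDerivWithinAt)
      (fun t ht => by simp)
      (fun t ht => huS _ (hI _ (Ico_subset_Icc_self ht)))
      (fun t ht => (dw t ht).continuousAt.continuousWithinAt)
      (fun t ht => (dw t (Ico_subset_Icc_self ht)).hasDerivWithinAt)
      (fun t ht => by
        rw [dist_neg_neg, dist_eq_norm]; exact hw' _ (hI _ (Ico_subset_Icc_self ht)))
      (fun t ht => hwS _ (hI _ (Ico_subset_Icc_self ht)))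
      (by rw [neg_zero, dist_eq_norm]) (-s) (right_mem_Icc.2 h0')
    rw [dist_eq_norm, zero_add, sub_zero, neg_neg] at key
    rw [abs_of_nonpos h0]
    exact key.trans (gronwallBound_le_mul_exp (by exact_mod_cast hK) hη h0')

/-- Quadratic Taylor estimate on a convex set where the derivative is Lipschitz. -/
lemma norm_sub_sub_fderiv_le {f : E → E} {S : Set E} {C : NNReal} (hS : Convex ℝ S)
    (hf : ∀ x ∈ S, DifferentiableAt ℝ f x) (hC : LipschitzOnWith C (fderiv ℝ f) S) {x y : E}
    (hx : x ∈ S) (hy : y ∈ S) :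
    ‖f y - f x - fderiv ℝ f x (y - x)‖ ≤ C * ‖y - x‖ ^ 2 := by
  have hsub := hS.segment_subset hx hy
  -- On the segment the derivative differs from its value at `x` by at most `C * ‖y - x‖`; the mean
  -- value inequality supplies the second factor `‖y - x‖`.
  have := (convex_segment (𝕜 := ℝ) x y).norm_image_sub_le_of_norm_fderiv_le' (𝕜 := ℝ)
    (f := f) (φ := fderiv ℝ f x) (C := C * ‖y - x‖) (fun z hz => hf z (hsub hz))
    (fun z hz => ?_) (left_mem_segment ℝ x y) (right_mem_segment ℝ x y)
  · rw [pow_two, ← mul_assoc]; exact this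
  · refine (hC.norm_sub_le (hsub hz) hx).trans ?_
    gcongr
    rw [segment_eq_image'] at hz
    obtain ⟨t, ⟨ht0, ht⟩, rfl⟩ := hz
    rw [add_sub_cancel_left, norm_smul, Real.norm_of_nonneg ht0]
    exact mul_le_of_le_one_left (norm_nonneg _) ht

variable [CompleteSpace E]

/-- Local flow of a vector field of class `C^2`, with the variational equation for its derivatives
along curves of initial points. -/
theorem exists_localFlow_hasDerivAt_variation {f : E → E} {x₀ : E} (hf : ContDiffAt ℝ 2 f x₀)
    {O : Set E} (hO : O ∈ 𝓝 x₀) :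
    ∃ r > 0, ∃ b > 0, ∃ α : E → ℝ → E, ∀ x ∈ Metric.ball x₀ r, α x 0 = x ∧
      (∀ s ∈ Ioo (-b) b, α x s ∈ O ∧ HasDerivAt (α x) (f (α x s)) s) ∧
      ∀ v, ∃ w : ℝ → E, w 0 = v ∧
        ∀ s ∈ Ioo (-b) b, HasDerivAt w (fderiv ℝ f (α x s) (w s)) s ∧
          ∀ c : ℝ → E, c 0 = x → HasDerivAt c v 0 →
            HasDerivAt (fun τ => α (c τ) s) (w s) 0 := by
  -- a ball on which all estimates hold
  obtain ⟨K, s₁, hs₁, hK⟩ := (hf.of_le one_le_two).exists_lipschitzOnWith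
  obtain ⟨C, s₂, hs₂, hC⟩ :=
    (hf.fderiv_right (m := 1) (by norm_num)).exists_lipschitzOnWith
  have hdiff : ∀ᶠ x in 𝓝 x₀, DifferentiableAt ℝ f x :=
    (hf.eventually (by simp)).mono fun x hx => hx.differentiableAt (by simp)
  obtain ⟨a, ha, hball⟩ := Metric.mem_nhds_iff.1
    (inter_mem (inter_mem hs₁ hs₂) (inter_mem hdiff hO))
  set S := Metric.ball x₀ a
  have hKS : LipschitzOnWith (K + 1) f S :=
    (hK.mono fun x hx => (hball hx).1.1).weaken (by simp)
  have hCS : LipschitzOnWith C (fderiv ℝ f) S := hC.mono fun x hx => (hball hx).1.2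
  have hdS : ∀ x ∈ S, DifferentiableAt ℝ f x := fun x hx => (hball hx).2.1
  have hSO : S ⊆ O := fun x hx => (hball hx).2.2
  -- the flow of the tangent lift
  set g : E × E → E × E := fun z => (f z.1, fderiv ℝ f z.1 z.2) with hg
  have hgC : ContDiffAt ℝ 1 g (x₀, 0) := by
    have h1 : ContDiffAt ℝ 1 (fun z : E × E => f z.1) (x₀, 0) :=
      ContDiffAt.comp (x₀, (0 : E)) (hf.of_le one_le_two) contDiffAt_fst
    have h2 : ContDiffAt ℝ 1 (fun z : E × E => fderiv ℝ f z.1) (x₀, 0) :=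
      ContDiffAt.comp (x₀, (0 : E)) (f := fun z : E × E => z.1) (g := fderiv ℝ f)
        (hf.fderiv_right (m := 1) (by norm_num)) contDiffAt_fst
    exact h1.prodMk (h2.clm_apply contDiffAt_snd)
  -- The tangent lift is C¹ because `f` is C². Its solutions exist on a common time interval and
  -- depend jointly continuously on initial value and time, which confines them near `(x₀, 0)`.
  obtain ⟨ε, hε, a', R, _, _, hR, hpl⟩ := IsPicardLindelof.of_contDiffAt_one hgC
  obtain ⟨γ, hγ, hγc⟩ :=
    (hpl 0).exists_forall_mem_closedBall_eq_hasDerivWithinAt_continuousOn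
  simp only [zero_sub, zero_add] at hγ hγc
  have hcont : ContinuousAt γ ((x₀, 0), 0) :=
    hγc.continuousAt (prod_mem_nhds (Metric.closedBall_mem_nhds _ hR)
      (Icc_mem_nhds (by linarith) hε))
  have hγ0 : γ ((x₀, 0), 0) = (x₀, 0) := (hγ _ (Metric.mem_closedBall_self hR.le)).1
  have hN : Metric.ball x₀ (a / 2) ×ˢ Metric.ball (0 : E) 1 ∈ 𝓝 (γ ((x₀, 0), 0)) := by
    rw [hγ0]
    exact prod_mem_nhds (Metric.ball_mem_nhds _ (by positivity)) (Metric.ball_mem_nhds _ one_pos)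
  obtain ⟨δ, hδ, hδN⟩ := Metric.mem_nhds_iff.1 (hcont hN)
  obtain ⟨ρ, hρ, hρδ, hρR⟩ : ∃ ρ > 0, ρ ≤ δ ∧ ρ ≤ R := ⟨min δ R, lt_min hδ hR, min_le_left _ _,
    min_le_right _ _⟩
  obtain ⟨b, hb, hbδ, hbε⟩ : ∃ b > 0, b ≤ δ ∧ b ≤ ε := ⟨min δ ε, lt_min hδ hε, min_le_left _ _,
    min_le_right _ _⟩
  have hmem : ∀ x ∈ Metric.ball x₀ ρ, ∀ v ∈ Metric.ball (0 : E) ρ, ∀ s ∈ Ioo (-b) b,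
      (γ ((x, v), s)).1 ∈ Metric.ball x₀ (a / 2) ∧ ‖(γ ((x, v), s)).2‖ < 1 := by
    intro x hx v hv s hs
    have : ((x, v), s) ∈ Metric.ball ((x₀, (0 : E)), (0 : ℝ)) δ := by
      rw [← ball_prod_same, ← ball_prod_same]
      exact ⟨⟨Metric.ball_subset_ball hρδ hx, Metric.ball_subset_ball hρδ hv⟩, by
        rw [Real.ball_eq_Ioo]; exact ⟨by linarith [hs.1], by linarith [hs.2]⟩⟩
    have := hδN this
    simpa using this
  have hder : ∀ x ∈ Metric.ball x₀ ρ, ∀ v ∈ Metric.ball (0 : E) ρ, γ ((x, v), 0) = (x, v) ∧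
      ∀ s ∈ Ioo (-b) b,
      HasDerivAt (fun s => (γ ((x, v), s)).1) (f (γ ((x, v), s)).1) s ∧
      HasDerivAt (fun s => (γ ((x, v), s)).2)
        (fderiv ℝ f (γ ((x, v), s)).1 (γ ((x, v), s)).2) s := by
    intro x hx v hv
    have hxv : (x, v) ∈ Metric.closedBall (x₀, (0 : E)) R := by
      rw [← closedBall_prod_same]
      exact ⟨Metric.ball_subset_closedBall (Metric.ball_subset_ball hρR hx),
        Metric.ball_subset_closedBall (Metric.ball_subset_ball hρR hv)⟩
    refine ⟨(hγ _ hxv).1, fun s hs => ?_⟩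
    have h := ((hγ _ hxv).2 s ⟨by linarith [hs.1], by linarith [hs.2]⟩).hasDerivAt
      (Icc_mem_nhds (by linarith [hs.1]) (by linarith [hs.2]))
    have h1 := (hasFDerivAt_fst (𝕜 := ℝ) (p := γ ((x, v), s))).comp_hasDerivAt s h
    have h2 := (hasFDerivAt_snd (𝕜 := ℝ) (p := γ ((x, v), s))).comp_hasDerivAt s h
    exact ⟨h1, h2⟩
  have h0ρ : (0 : E) ∈ Metric.ball (0 : E) ρ := Metric.mem_ball_self hρ
  have hhalf : Metric.ball x₀ (a / 2) ⊆ S := Metric.ball_subset_ball (by linarith)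
  refine ⟨ρ, hρ, b, hb, fun x s => (γ ((x, 0), s)).1, fun x hx => ⟨by simp [(hder x hx 0 h0ρ).1],
    fun s hs => ⟨hSO (hhalf (hmem x hx 0 h0ρ s hs).1), ((hder x hx 0 h0ρ).2 s hs).1⟩,
    fun v => ?_⟩⟩
  -- rescale `v` into the domain of the flow
  set l : ℝ := (‖v‖ + 1) / (ρ / 2) with hl
  have hl0 : 0 < l := by positivity
  set v' : E := l⁻¹ • v with hv'
  have hv'v : l • v' = v := by rw [hv', smul_smul, mul_inv_cancel₀ hl0.ne', one_smul]
  have hv'm : v' ∈ Metric.ball (0 : E) ρ := by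
    rw [mem_ball_zero_iff, hv', norm_smul, norm_inv, Real.norm_of_nonneg hl0.le, hl, inv_div,
      div_mul_eq_mul_div, div_lt_iff₀ (by positivity)]
    nlinarith [norm_nonneg v]
  set p : ℝ → E := fun s => (γ ((x, v'), s)).1 with hp
  set q : ℝ → E := fun s => (γ ((x, v'), s)).2 with hq
  have hpq0 := (hder x hx v' hv'm).1
  have hpd : ∀ s ∈ Ioo (-b) b, HasDerivAt p (f (p s)) s := fun s hs => ((hder x hx v' hv'm).2 s hs).1
  have hqd : ∀ s ∈ Ioo (-b) b, HasDerivAt q (fderiv ℝ f (p s) (q s)) s := fun s hs => ((hder x hx v' hv'm).2 s hs).2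
  have hpm : ∀ s ∈ Ioo (-b) b, p s ∈ Metric.ball x₀ (a / 2) := fun s hs => (hmem x hx v' hv'm s hs).1
  have hqm : ∀ s ∈ Ioo (-b) b, ‖q s‖ < 1 := fun s hs => (hmem x hx v' hv'm s hs).2
  -- The curve `p + τ l q` starts at `x + τ v` and satisfies the equation of `f` up to a Taylor
  -- error `C |τ l|²`, since `‖q‖ < 1`. Grönwall compares it with the true trajectory from `y`.
  have hest : ∀ y ∈ Metric.ball x₀ ρ, ∀ τ : ℝ, |τ * l| < a / 2 → ∀ s ∈ Ioo (-b) b,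
      ‖(γ ((y, 0), s)).1 - (p s + τ • (l • q s))‖ ≤
        (‖y - (x + τ • v)‖ + C * |τ * l| ^ 2) * Real.exp ((K + 1 : NNReal) * |s|) := by
    intro y hy τ hτ s hs
    have hwS : ∀ s ∈ Ioo (-b) b, p s + τ • (l • q s) ∈ S := by
      intro s hs
      have h1 := hpm s hs
      rw [Metric.mem_ball, dist_eq_norm] at h1 ⊢
      have h2 : ‖τ • (l • q s)‖ ≤ |τ * l| := by
        rw [smul_smul, norm_smul, Real.norm_eq_abs]
        exact mul_le_of_le_one_right (abs_nonneg _) (hqm s hs).le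
      calc ‖p s + τ • (l • q s) - x₀‖ = ‖(p s - x₀) + τ • (l • q s)‖ := by congr 1; abel
        _ ≤ ‖p s - x₀‖ + ‖τ • (l • q s)‖ := norm_add_le _ _
        _ < a := by linarith
    have key := norm_sub_le_of_approx_trajectory (u := fun s => (γ ((y, 0), s)).1)
      (w := fun s => p s + τ • (l • q s))
      (w' := fun s => f (p s) + τ • (l • fderiv ℝ f (p s) (q s)))
      (b := b) (η := C * |τ * l| ^ 2) (by simp) hKS (by positivity)
      (fun s hs => ((hder y hy 0 h0ρ).2 s hs).1)
      (fun s hs => hhalf (hmem y hy 0 h0ρ s hs).1)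
      (fun s hs => (hpd s hs).add (((hqd s hs).const_smul l).const_smul τ)) hwS
      (fun s hs => by
        rw [norm_sub_rev]
        have := norm_sub_sub_fderiv_le (convex_ball x₀ a) hdS hCS (hhalf (hpm s hs)) (hwS s hs)
        simp only [add_sub_cancel_left, map_smul] at this
        rw [← sub_sub]
        refine this.trans ?_
        gcongr
        rw [smul_smul, norm_smul, Real.norm_eq_abs]
        exact mul_le_of_le_one_right (abs_nonneg _) (hqm s hs).le) hs
    have e1 : p 0 = x := by simp [hp, hpq0]
    have e2 : q 0 = v' := by simp [hq, hpq0]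
    simp only [e1, e2, hv'v, (hder y hy 0 h0ρ).1] at key
    exact key
  -- The case `y = x`, `τ = 0`: the base curve does not depend on the initial tangent vector.
  have hαp : ∀ s ∈ Ioo (-b) b, (γ ((x, 0), s)).1 = p s := by
    intro s hs
    have := hest x hx 0 (by simpa using by positivity) s hs
    simpa [sub_eq_zero] using this
  refine ⟨fun s => l • q s, by simp [hq, hpq0, hv'v], fun s hs => ⟨?_, fun c hc0 hc => ?_⟩⟩
  · simp only [hαp s hs, map_smul]
    exact (hqd s hs).const_smul l
  -- With `y = c τ`, both terms of the bound are `o(τ)`: the first because `c` has velocity `v`, the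
  -- second because it is quadratic.
  · rw [hasDerivAt_iff_isLittleO_nhds_zero]
    simp only [zero_add, hc0, hαp s hs]
    set M := Real.exp ((K + 1 : NNReal) * |s|)
    have hc' : (fun τ : ℝ => c τ - (x + τ • v)) =o[𝓝 0] fun τ : ℝ => τ := by
      have := hasDerivAt_iff_isLittleO_nhds_zero.1 hc
      simpa [hc0, sub_sub] using this
    have hsq : (fun τ : ℝ => C * |τ * l| ^ 2) =o[𝓝 0] fun τ : ℝ => τ := by
      have h1 : (fun τ : ℝ => τ ^ 2) =o[𝓝 0] fun τ : ℝ => τ := by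
        simpa using Asymptotics.isLittleO_pow_pow (𝕜 := ℝ) (one_lt_two)
      refine (h1.const_mul_left (C * l ^ 2 : ℝ)).congr_left fun τ => ?_
      rw [sq_abs]; ring
    refine Asymptotics.IsBigO.trans_isLittleO (g := fun τ : ℝ =>
      ‖c τ - (x + τ • v)‖ + C * |τ * l| ^ 2) ?_ (hc'.norm_left.add hsq)
    refine Asymptotics.IsBigO.of_bound M ?_
    have hcx : ∀ᶠ τ in 𝓝 (0 : ℝ), c τ ∈ Metric.ball x₀ ρ :=
      hc.continuousAt.eventually_mem (by rw [hc0]; exact Metric.isOpen_ball.mem_nhds hx)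
    have hτ : ∀ᶠ τ in 𝓝 (0 : ℝ), |τ * l| < a / 2 := by
      have : ContinuousAt (fun τ : ℝ => |τ * l|) 0 := by fun_prop
      exact this.eventually_lt continuousAt_const (by simpa using by positivity)
    filter_upwards [hcx, hτ] with τ h1 h2
    have := hest (c τ) h1 τ h2 s hs
    rw [sub_sub, Real.norm_of_nonneg (by positivity), mul_comm]
    exact this

end Flow

/-! ### The constant rank theorem and embedded images -/

section ConstantRank

variable {V E : Type*} [NormedAddCommGroup V] [NormedSpace ℝ V] [NormedAddCommGroup E]
  [NormedSpace ℝ E]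

/-- Inverse function theorem for maps smooth on an open set: the inverse is smooth on the whole
target of a suitable restriction. -/
theorem exists_openPartialHomeomorph_of_hasFDerivAt_id [CompleteSpace E] {f : E → E} {U : Set E}
    (hU : IsOpen U) (hf : ContDiffOn ℝ ∞ f U) {x : E} (hx : x ∈ U)
    (hd : HasFDerivAt f (ContinuousLinearMap.id ℝ E) x) :
    ∃ Φ : OpenPartialHomeomorph E E, x ∈ Φ.source ∧ Φ.source ⊆ U ∧ ⇑Φ = f ∧
      ContDiffOn ℝ ∞ Φ.symm Φ.target := by
  have hfx : ContDiffAt ℝ ∞ f x := hf.contDiffAt (hU.mem_nhds hx)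
  have hd' : HasFDerivAt f ((ContinuousLinearEquiv.refl ℝ E : E ≃L[ℝ] E) : E →L[ℝ] E) x := hd
  set Φ₀ := hfx.toOpenPartialHomeomorph f hd' (by simp) with hΦ₀
  have hcont : ContinuousOn (fderiv ℝ f) U := hf.continuousOn_fderiv_of_isOpen hU (by simp)
  -- The inverse is smooth at the image of each point with invertible derivative. Such points form
  -- an open set, to which the source is cut down.
  set W : Set E := U ∩ fderiv ℝ f ⁻¹' (range ((↑) : (E ≃L[ℝ] E) → E →L[ℝ] E))
  have hW : IsOpen W := hcont.isOpen_inter_preimage hU ContinuousLinearEquiv.isOpen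
  have hxW : x ∈ W := ⟨hx, ContinuousLinearEquiv.refl ℝ E, by rw [hd'.fderiv]⟩
  have hcoe : ⇑Φ₀ = f := hfx.toOpenPartialHomeomorph_coe hd' (by simp)
  refine ⟨Φ₀.restrOpen W hW, ?_, ?_, ?_, ?_⟩
  · rw [Φ₀.restrOpen_source]
    exact ⟨hfx.mem_toOpenPartialHomeomorph_source hd' (by simp), hxW⟩
  · rw [Φ₀.restrOpen_source]
    exact fun y hy => hy.2.1
  · exact hcoe
  · intro y hy
    have hy' := (Φ₀.restrOpen W hW).map_target hy
    rw [Φ₀.restrOpen_source] at hy'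
    obtain ⟨e, he⟩ := hy'.2.2
    have hfy : ContDiffAt ℝ ∞ f ((Φ₀.restrOpen W hW).symm y) := hf.contDiffAt (hU.mem_nhds hy'.2.1)
    refine ((Φ₀.restrOpen W hW).contDiffAt_symm (f₀' := e) hy ?_ ?_).contDiffWithinAt
    · rw [he]
      exact (hfy.differentiableAt (by simp)).hasFDerivAt
    · exact hfy

/-- By rank-nullity the larger kernel `ker (A ∘ T) ⊇ ker T` has no larger dimension, so the two
agree. -/
lemma ker_le_ker_of_finrank_range_le [FiniteDimensional ℝ V] (T : V →ₗ[ℝ] E) (A : E →ₗ[ℝ] V)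
    (h : Module.finrank ℝ (LinearMap.range T) ≤ Module.finrank ℝ (LinearMap.range (A ∘ₗ T))) :
    LinearMap.ker (A ∘ₗ T) ≤ LinearMap.ker T := by
  have h1 := LinearMap.finrank_range_add_finrank_ker T
  have h2 := LinearMap.finrank_range_add_finrank_ker (A ∘ₗ T)
  exact (Submodule.eq_of_le_of_finrank_le (LinearMap.ker_le_ker_comp T A) (by omega)).ge

/-- Project onto the range of `L`, then apply a section of `L` over it. The projectors `L A` and `A
L` then encode complements of the range and of the kernel. -/
lemma exists_generalizedInverse [FiniteDimensional ℝ V] [FiniteDimensional ℝ E] (L : V →L[ℝ] E) :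
    ∃ A : E →L[ℝ] V, (∀ v, L (A (L v)) = L v) ∧ ∀ e, A (L (A e)) = A e := by
  obtain ⟨B, hB⟩ := (L : V →ₗ[ℝ] E).rangeRestrict.exists_rightInverse_of_surjective
    (LinearMap.range_rangeRestrict _)
  obtain ⟨p, hp⟩ := (LinearMap.range (L : V →ₗ[ℝ] E)).subtype.exists_leftInverse_of_injective
    (Submodule.ker_subtype _)
  have hB' : ∀ w, L (B w) = w := fun w => congrArg Subtype.val (LinearMap.congr_fun hB w)
  have hp' : ∀ w : LinearMap.range (L : V →ₗ[ℝ] E), p w = w := fun w => LinearMap.congr_fun hp w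
  refine ⟨LinearMap.toContinuousLinearMap (B ∘ₗ p), fun v => ?_, fun e => ?_⟩
  · have := hp' ⟨L v, v, rfl⟩
    simp only [LinearMap.coe_toContinuousLinearMap', LinearMap.comp_apply] at *
    rw [this, hB']
  · simp only [LinearMap.coe_toContinuousLinearMap', LinearMap.comp_apply]
    rw [hB', hp']

/-- Constant rank theorem: near a point where its rank is locally constant, a smooth map is, up to
local diffeomorphisms of the source and of the target, its derivative at that point. -/
theorem exists_factorization_of_finrank_range_fderiv_eq [FiniteDimensional ℝ V]
    [FiniteDimensional ℝ E] {f : V → E} {O : Set V} (hO : IsOpen O)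
    (hf : ContDiffOn ℝ ∞ f O) {t₁ : V} (ht₁ : t₁ ∈ O)
    (hrank : ∀ t ∈ O, Module.finrank ℝ (LinearMap.range (fderiv ℝ f t : V →ₗ[ℝ] E)) ≤
      Module.finrank ℝ (LinearMap.range (fderiv ℝ f t₁ : V →ₗ[ℝ] E))) :
    ∃ (Θ : OpenPartialHomeomorph E E) (G : OpenPartialHomeomorph V V) (δ : ℝ),
      ContDiffOn ℝ ∞ Θ Θ.source ∧ ContDiffOn ℝ ∞ Θ.symm Θ.target ∧ 0 < δ ∧
      G.source ⊆ O ∧ t₁ ∈ G.source ∧ G t₁ = 0 ∧ Metric.ball 0 δ ⊆ G.target ∧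
      ∀ u ∈ Metric.ball 0 δ, fderiv ℝ f t₁ u ∈ Θ.source ∧
        f (G.symm u) = Θ (fderiv ℝ f t₁ u) := by
  have : CompleteSpace E := FiniteDimensional.complete ℝ E
  have : CompleteSpace V := FiniteDimensional.complete ℝ V
  set L := fderiv ℝ f t₁ with hL
  have hLd : HasFDerivAt f L t₁ :=
    ((hf.contDiffAt (hO.mem_nhds ht₁)).differentiableAt (by simp)).hasFDerivAt
  obtain ⟨A, hLAL, hALA⟩ := exists_generalizedInverse L
  -- straightening of the target
  set θ : E → E := fun e => f (t₁ + A e) + (e - L (A e)) with hθ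
  set U : Set E := (fun e => t₁ + A e) ⁻¹' O
  have hU : IsOpen U := hO.preimage (by fun_prop)
  have hθC : ContDiffOn ℝ ∞ θ U := by
    refine (hf.comp (g := f) (f := fun e => t₁ + A e) ?_ fun e he => he).add ?_
    · exact (contDiff_const.add A.contDiff).contDiffOn
    · exact (contDiff_id.sub (L.contDiff.comp A.contDiff)).contDiffOn
  have h0U : (0 : E) ∈ U := by simpa [U] using ht₁
  -- `θ` follows `f` on the range of `L` and is a translation on `ker A`; its derivative at `0` is
  -- `L A + (1 - L A)`.
  have hθd : HasFDerivAt θ (ContinuousLinearMap.id ℝ E) 0 := by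
    have h1 : HasFDerivAt (fun e => t₁ + A e) A 0 := A.hasFDerivAt.const_add t₁
    have h2 : HasFDerivAt (fun e => f (t₁ + A e)) (L.comp A) 0 := by
      refine HasFDerivAt.comp (0 : E) (g := f) ?_ h1
      simpa using hLd
    refine (h2.add ((hasFDerivAt_id (0 : E)).sub (L.comp A).hasFDerivAt)).congr_fderiv ?_
    ext e; simp
  obtain ⟨Θ, h0Θ, hΘU, hΘ, hΘs⟩ :=
    exists_openPartialHomeomorph_of_hasFDerivAt_id hU hθC h0U hθd
  have hΘ0 : Θ 0 = f t₁ := by simp [hΘ, hθ]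
  have hft₁ : f t₁ ∈ Θ.target := hΘ0 ▸ Θ.map_source h0Θ
  have hΘs0 : Θ.symm (f t₁) = 0 := by rw [← hΘ0, Θ.left_inv h0Θ]
  -- straightening of the source
  set γ : V → V := fun t => A (Θ.symm (f t)) + ((t - t₁) - A (L (t - t₁))) with hγ
  set U' : Set V := O ∩ f ⁻¹' Θ.target
  have hU' : IsOpen U' := hf.continuousOn.isOpen_inter_preimage hO Θ.open_target
  have ht₁U' : t₁ ∈ U' := ⟨ht₁, hft₁⟩
  have hΘf : ContDiffOn ℝ ∞ (fun t => Θ.symm (f t)) U' :=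
    hΘs.comp (hf.mono fun t ht => ht.1) fun t ht => ht.2
  have hγC : ContDiffOn ℝ ∞ γ U' := by
    refine (A.contDiff.comp_contDiffOn hΘf).add ?_
    have : ContDiff ℝ ∞ fun t : V => (t - t₁) - A (L (t - t₁)) := by fun_prop
    exact this.contDiffOn
  have hγd : HasFDerivAt γ (ContinuousLinearMap.id ℝ V) t₁ := by
    have h1 : HasFDerivAt Θ.symm (ContinuousLinearMap.id ℝ E) (f t₁) := by
      refine Θ.hasFDerivAt_symm (f' := ContinuousLinearEquiv.refl ℝ E) hft₁ ?_
      rw [hΘs0, hΘ]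
      exact hθd
    have h2 : HasFDerivAt (fun t => Θ.symm (f t)) L t₁ := h1.comp t₁ hLd
    have h3 : HasFDerivAt (fun t => A (Θ.symm (f t))) (A.comp L) t₁ := A.hasFDerivAt.comp t₁ h2
    have h4 : HasFDerivAt (fun t : V => t - t₁) (ContinuousLinearMap.id ℝ V) t₁ :=
      (hasFDerivAt_id t₁).sub_const t₁
    have h5 : HasFDerivAt (fun t : V => A (L (t - t₁))) (A.comp L) t₁ :=
      (A.comp L).hasFDerivAt.comp t₁ h4
    refine (h3.add (h4.sub h5)).congr_fderiv ?_
    ext e; simp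
  obtain ⟨G, ht₁G, hGU, hG, hGs⟩ :=
    exists_openPartialHomeomorph_of_hasFDerivAt_id hU' hγC ht₁U' hγd
  have hG0 : G t₁ = 0 := by simp [hG, hγ, hΘs0]
  have h0G : (0 : V) ∈ G.target := hG0 ▸ G.map_source ht₁G
  -- the map in straightened coordinates
  set h : V → E := fun u => Θ.symm (f (G.symm u)) with hh
  have hhC : ContDiffOn ℝ ∞ h G.target := hΘf.comp hGs fun u hu => hGU (G.map_target hu)
  -- Applying `A L` to `γ (G.symm u) = u` kills the summand in the range of `1 - A L` and leaves `A
  -- h`.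
  have hAh : ∀ u ∈ G.target, A (h u) = A (L u) := by
    intro u hu
    have h1 : γ (G.symm u) = u := by rw [← hG]; exact G.right_inv hu
    have h2 := congrArg (fun v => A (L v)) h1
    simp only [hγ, map_add, map_sub, hALA, sub_self, add_zero] at h2
    exact h2
  have hhd : ∀ u ∈ G.target, ∀ κ, A (L κ) = 0 → fderiv ℝ h u κ = 0 := by
    intro u hu κ hκ
    have hhu : HasFDerivAt h (fderiv ℝ h u) u :=
      ((hhC.contDiffAt (G.open_target.mem_nhds hu)).differentiableAt (by simp)).hasFDerivAt
    have hc : A.comp (fderiv ℝ h u) = A.comp L := by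
      have h1 : HasFDerivAt (fun u => A (h u)) (A.comp (fderiv ℝ h u)) u := A.hasFDerivAt.comp u hhu
      have h2 : HasFDerivAt (fun u => A (h u)) (A.comp L) u :=
        (A.comp L).hasFDerivAt.congr_of_eventuallyEq
          (eventually_of_mem (G.open_target.mem_nhds hu) hAh)
      exact h1.unique h2
    -- Here maximality of the rank enters: `rank h' ≤ rank f' ≤ rank L ≤ rank (A L) = rank (A h')`.
    -- Hence `h'` vanishes wherever `A h' = A L` does.
    have hr : Module.finrank ℝ (LinearMap.range (fderiv ℝ h u : V →ₗ[ℝ] E)) ≤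
        Module.finrank ℝ (LinearMap.range ((A : E →ₗ[ℝ] V) ∘ₗ (fderiv ℝ h u : V →ₗ[ℝ] E))) := by
      have e1 : (A : E →ₗ[ℝ] V) ∘ₗ (fderiv ℝ h u : V →ₗ[ℝ] E) =
          (A : E →ₗ[ℝ] V) ∘ₗ (L : V →ₗ[ℝ] E) := by
        ext v; exact congrArg (fun T : V →L[ℝ] V => T v) hc
      have hGu := hGU (G.map_target hu)
      have e2 : fderiv ℝ h u = (fderiv ℝ Θ.symm (f (G.symm u))).comp
          ((fderiv ℝ f (G.symm u)).comp (fderiv ℝ G.symm u)) := by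
        have d1 := ((hΘs.contDiffAt (Θ.open_target.mem_nhds hGu.2)).differentiableAt
          (by simp)).hasFDerivAt
        have d2 := ((hf.contDiffAt (hO.mem_nhds hGu.1)).differentiableAt (by simp)).hasFDerivAt
        have d3 := ((hGs.contDiffAt (G.open_target.mem_nhds hu)).differentiableAt
          (by simp)).hasFDerivAt
        exact (HasFDerivAt.comp u d1 (HasFDerivAt.comp u d2 d3)).fderiv
      rw [e1, e2]
      calc _ ≤ Module.finrank ℝ (LinearMap.range (fderiv ℝ f (G.symm u) : V →ₗ[ℝ] E)) := by
            have : LinearMap.range (((fderiv ℝ Θ.symm (f (G.symm u))).comp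
                ((fderiv ℝ f (G.symm u)).comp (fderiv ℝ G.symm u)) : V →L[ℝ] E) : V →ₗ[ℝ] E) ≤
                (LinearMap.range (fderiv ℝ f (G.symm u) : V →ₗ[ℝ] E)).map
                  (fderiv ℝ Θ.symm (f (G.symm u)) : E →ₗ[ℝ] E) := by
              rintro _ ⟨v, rfl⟩
              exact ⟨_, ⟨fderiv ℝ G.symm u v, rfl⟩, rfl⟩
            exact (Submodule.finrank_mono this).trans (Submodule.finrank_map_le _ _)
        _ ≤ Module.finrank ℝ (LinearMap.range (L : V →ₗ[ℝ] E)) := hrank _ hGu.1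
        _ ≤ _ := by
            have : LinearMap.range (L : V →ₗ[ℝ] E) ≤
                (LinearMap.range ((A : E →ₗ[ℝ] V) ∘ₗ (L : V →ₗ[ℝ] E))).map (L : V →ₗ[ℝ] E) := by
              rintro _ ⟨v, rfl⟩
              exact ⟨_, ⟨v, rfl⟩, hLAL v⟩
            exact (Submodule.finrank_mono this).trans (Submodule.finrank_map_le _ _)
    have hker := ker_le_ker_of_finrank_range_le _ _ hr
    refine LinearMap.mem_ker.1 (hker (LinearMap.mem_ker.2 ?_))
    exact (congrArg (fun T : V →L[ℝ] V => T κ) hc).trans hκ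
  -- a small ball
  obtain ⟨δ₁, hδ₁, hδ₁G⟩ := Metric.mem_nhds_iff.1 (G.open_target.mem_nhds h0G)
  have hev : ∀ᶠ u in 𝓝 (0 : V), u ∈ Metric.ball (0 : V) δ₁ ∧ A (L u) ∈ Metric.ball (0 : V) δ₁ ∧
      t₁ + A (L u) ∈ G.source ∧ L u ∈ Θ.source := by
    have c1 : ContinuousAt (fun u => A (L u)) 0 := by fun_prop
    have c2 : ContinuousAt (fun u => t₁ + A (L u)) 0 := by fun_prop
    have c3 : ContinuousAt (fun u => L u) 0 := by fun_prop
    have c0 : ∀ᶠ u in 𝓝 (0 : V), u ∈ Metric.ball (0 : V) δ₁ := Metric.ball_mem_nhds 0 hδ₁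
    refine c0.and ((c1.eventually_mem ?_).and ((c2.eventually_mem ?_).and (c3.eventually_mem ?_)))
    · simpa using Metric.ball_mem_nhds 0 hδ₁
    · simpa using G.open_source.mem_nhds ht₁G
    · simpa using Θ.open_source.mem_nhds h0Θ
  obtain ⟨δ, hδ, hδball⟩ := Metric.eventually_nhds_iff_ball.1 hev
  refine ⟨Θ, G, δ, ?_, hΘs, hδ, fun t ht => (hGU ht).1, ht₁G, hG0,
    fun u hu => hδ₁G (hδball u hu).1, fun u hu => ⟨(hδball u hu).2.2.2, ?_⟩⟩
  · rw [hΘ]; exact hθC.mono hΘU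
  · obtain ⟨hu1, hu2, hu3, hu4⟩ := hδball u hu
    -- `u - c` lies in the kernel of `A L`, so `h u = h c`; and since `c` is fixed by `A L`, the
    -- formulas for `θ` and `γ` give `h c = L u` explicitly.
    set c := A (L u) with hc
    have hcc : A (L c) = c := hALA _
    have hLc : L c = L u := hLAL u
    -- `h` is constant on the segment from `c` to `u`
    have hseg : ∀ τ ∈ Icc (0 : ℝ) 1, c + τ • (u - c) ∈ G.target := by
      intro τ hτ
      have := (convex_ball (0 : V) δ₁).add_smul_sub_mem hu2 hu1 hτ
      exact hδ₁G this
    have hdτ : ∀ τ ∈ Icc (0 : ℝ) 1, HasDerivAt (fun τ : ℝ => h (c + τ • (u - c))) 0 τ := by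
      intro τ hτ
      have d1 := ((hhC.contDiffAt (G.open_target.mem_nhds (hseg τ hτ))).differentiableAt
        (by simp)).hasFDerivAt
      have d2 : HasDerivAt (fun τ : ℝ => c + τ • (u - c)) (u - c) τ := by
        simpa using ((hasDerivAt_id τ).smul_const (u - c)).const_add c
      have d3 := d1.comp_hasDerivAt τ d2
      rw [hhd _ (hseg τ hτ) (u - c) (by rw [map_sub, map_sub, hcc, sub_self])] at d3
      exact d3
    have hconst : h u = h c := by
      have := constant_of_has_deriv_right_zero (f := fun τ : ℝ => h (c + τ • (u - c))) (a := 0)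
        (b := 1) (fun τ hτ => (hdτ τ hτ).continuousAt.continuousWithinAt)
        (fun τ hτ => (hdτ τ (Ico_subset_Icc_self hτ)).hasDerivWithinAt) 1 (by simp)
      simpa using this
    have hθc : f (t₁ + c) = Θ (L u) := by
      rw [hΘ]
      simp [hθ, ← hc, hLc]
    have hGc : G (t₁ + c) = c := by
      rw [hG]
      simp only [hγ, hθc, Θ.left_inv hu4, add_sub_cancel_left, hcc, sub_self, add_zero]
      exact hc.symm
    have hhc : h c = L u := by
      have : G.symm c = t₁ + c := by rw [← G.left_inv hu3, hGc]
      simp only [hh, this, hθc, Θ.left_inv hu4]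
    have hfu : f (G.symm u) ∈ Θ.target := (hGU (G.map_target (hδ₁G hu1))).2
    rw [← hhc, ← hconst]
    exact (Θ.right_inv hfu).symm

/-- A smooth map whose rank is locally maximal at a point maps small neighbourhoods of this point
onto embedded submanifolds. -/
theorem exists_image_eventually_mem_iff [FiniteDimensional ℝ V]
    [FiniteDimensional ℝ E] {f : V → E} {O : Set V} (hO : IsOpen O)
    (hf : ContDiffOn ℝ ∞ f O) {t₁ : V} (ht₁ : t₁ ∈ O)
    (hrank : ∀ t ∈ O, Module.finrank ℝ (LinearMap.range (fderiv ℝ f t : V →ₗ[ℝ] E)) ≤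
      Module.finrank ℝ (LinearMap.range (fderiv ℝ f t₁ : V →ₗ[ℝ] E))) :
    ∃ (D : Set V) (Θ : OpenPartialHomeomorph E E) (W : Submodule ℝ E), IsOpen D ∧ t₁ ∈ D ∧ D ⊆ O ∧
      ContDiffOn ℝ ∞ Θ Θ.source ∧ ContDiffOn ℝ ∞ Θ.symm Θ.target ∧
      ∀ x ∈ f '' D, x ∈ Θ.target ∧ ∀ᶠ y in 𝓝 x, (y ∈ f '' D ↔ Θ.symm y ∈ W) := by
  obtain ⟨Θ, G, δ, hΘ, hΘs, hδ, hGO, ht₁G, hG0, hδG, hfac⟩ :=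
    exists_factorization_of_finrank_range_fderiv_eq hO hf ht₁ hrank
  set L := fderiv ℝ f t₁ with hL
  obtain ⟨A, hLAL, hALA⟩ := exists_generalizedInverse L
  set D : Set V := G.source ∩ G ⁻¹' Metric.ball 0 δ with hD
  have himg : ∀ y, y ∈ f '' D ↔ ∃ u ∈ Metric.ball 0 δ, y = Θ (L u) := by
    intro y
    constructor
    · rintro ⟨t, ht, rfl⟩
      refine ⟨G t, ht.2, ?_⟩
      rw [← (hfac _ ht.2).2, G.left_inv ht.1]
    · rintro ⟨u, hu, rfl⟩
      refine ⟨G.symm u, ⟨G.map_target (hδG hu), ?_⟩, (hfac u hu).2⟩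
      rw [mem_preimage, G.right_inv (hδG hu)]
      exact hu
  refine ⟨D, Θ, LinearMap.range (L : V →ₗ[ℝ] E), G.isOpen_inter_preimage Metric.isOpen_ball,
    ⟨ht₁G, by simpa [hG0] using hδ⟩, fun t ht => hGO ht.1, hΘ, hΘs, fun x hx => ?_⟩
  obtain ⟨u₀, hu₀, rfl⟩ := (himg x).1 hx
  have hsrc := (hfac u₀ hu₀).1
  refine ⟨Θ.map_source hsrc, ?_⟩
  -- When `Θ.symm y` is in the range of `L`, this point is an `L`-preimage of it. It depends
  -- continuously on `y` and equals `u₀` at the base point, so it stays in the ball.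
  have hcont : ContinuousAt (fun y => u₀ + A (Θ.symm y - L u₀)) (Θ (L u₀)) := by
    have := Θ.continuousAt_symm (Θ.map_source hsrc)
    exact continuousAt_const.add (A.continuous.continuousAt.comp (this.sub continuousAt_const))
  have hball : ∀ᶠ y in 𝓝 (Θ (L u₀)), u₀ + A (Θ.symm y - L u₀) ∈ Metric.ball (0 : V) δ := by
    refine hcont.eventually_mem (Metric.isOpen_ball.mem_nhds ?_)
    simpa [Θ.left_inv hsrc] using hu₀
  filter_upwards [hball, Θ.open_target.mem_nhds (Θ.map_source hsrc)] with y hy hyt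
  rw [himg]
  constructor
  · rintro ⟨u, hu, rfl⟩
    exact ⟨u, (Θ.left_inv (hfac u hu).1).symm⟩
  · rintro ⟨u', hu'⟩
    refine ⟨_, hy, ?_⟩
    have hu'' : L u' = Θ.symm y := hu'
    rw [← hu'', ← map_sub, map_add, hLAL, map_sub, add_sub_cancel, hu'', Θ.right_inv hyt]

end ConstantRank

/-! ### Exterior calculus on a vector space -/

section VectorSpaceForms

variable {E : Type*} [NormedAddCommGroup E] [NormedSpace ℝ E]

lemma _root_.ContDiffOn.extDeriv_of_isOpen {p : ℕ} {a : E → E [⋀^Fin p]→L[ℝ] ℝ} {s : Set E}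
    (hs : IsOpen s) (ha : ContDiffOn ℝ ∞ a s) : ContDiffOn ℝ ∞ (extDeriv a) s := by
  have h := (ContinuousAlternatingMap.alternatizeUncurryFinCLM ℝ E ℝ).contDiff.comp_contDiffOn
    (ha.fderiv_of_isOpen hs (m := ∞) (by simp))
  exact h

lemma _root_.ContDiffOn.curryLeft_apply {p : ℕ} {a : E → E [⋀^Fin (p + 1)]→L[ℝ] ℝ} {f : E → E}
    {s : Set E} (ha : ContDiffOn ℝ ∞ a s) (hf : ContDiffOn ℝ ∞ f s) :
    ContDiffOn ℝ ∞ (fun y => (a y).curryLeft (f y)) s := by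
  have h := (((ContinuousAlternatingMap.curryLeftLI (𝕜 := ℝ) (E := E) (F := ℝ)
    (n := p)).toContinuousLinearMap.contDiff).comp_contDiffOn ha).clm_apply hf
  exact h

lemma _root_.DifferentiableAt.curryLeft_apply {p : ℕ} {a : E → E [⋀^Fin (p + 1)]→L[ℝ] ℝ}
    {f : E → E} {y : E} (ha : DifferentiableAt ℝ a y) (hf : DifferentiableAt ℝ f y) :
    DifferentiableAt ℝ (fun y => (a y).curryLeft (f y)) y := by
  have h : DifferentiableAt ℝ (fun y => (a y).curryLeft) y :=
    DifferentiableAt.comp (F := E [⋀^Fin (p + 1)]→L[ℝ] ℝ) (G := E →L[ℝ] E [⋀^Fin p]→L[ℝ] ℝ)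
      (g := ContinuousAlternatingMap.curryLeftLI (𝕜 := ℝ) (E := E) (F := ℝ) (n := p)) y
      (ContinuousAlternatingMap.curryLeftLI (𝕜 := ℝ) (E := E) (F := ℝ)
        (n := p)).toContinuousLinearMap.differentiableAt ha
  exact h.clm_apply hf

/-- The Lie derivative of a `1`-form on a vector space. -/
lemma extDeriv_curryLeft_add_curryLeft_extDeriv_apply {b : E → E [⋀^Fin 1]→L[ℝ] ℝ} {f : E → E}
    {y : E} (hb : DifferentiableAt ℝ b y) (hf : DifferentiableAt ℝ f y) (v : E) :
    extDeriv (fun y => (b y).curryLeft (f y)) y ![v] + (extDeriv b y).curryLeft (f y) ![v] =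
      fderiv ℝ b y (f y) ![v] + b y ![fderiv ℝ f y v] := by
  have hc := hb.curryLeft_apply hf
  have e1 : extDeriv (fun y => (b y).curryLeft (f y)) y ![v] =
      fderiv ℝ b y v ![f y] + b y ![fderiv ℝ f y v] := by
    rw [extDeriv_apply hc, Fin.sum_univ_one]
    have e0 : (fun z => (b z).curryLeft (f z) (Fin.removeNth 0 ![v])) =
        fun z => b z fun _ => f z := by
      funext z
      refine congrArg (b z) ?_
      funext i
      fin_cases i
      rfl
    rw [e0, fderiv_continuousAlternatingMap_apply_apply hb fun _ => hf, Fin.sum_univ_one]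
    simp only [Fin.val_zero, pow_zero, one_smul]
    congr 2
    · funext i; fin_cases i; rfl
    · funext i; fin_cases i; rfl
  -- The subtracted term cancels the derivative of `b` in the direction `v` from `e1`.
  have e2 : (extDeriv b y).curryLeft (f y) ![v] =
      fderiv ℝ b y (f y) ![v] - fderiv ℝ b y v ![f y] := by
    have e3 : (extDeriv b y).curryLeft (f y) ![v] = extDeriv b y ![f y, v] := rfl
    have e4 : Fin.removeNth 0 ![f y, v] = ![v] := by funext i; fin_cases i; rfl
    have e5 : Fin.removeNth 1 ![f y, v] = ![f y] := by funext i; fin_cases i; rfl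
    rw [e3, extDeriv_apply hb, Fin.sum_univ_two, e4, e5,
      fderiv_continuousAlternatingMap_apply_const_apply hb,
      fderiv_continuousAlternatingMap_apply_const_apply hb]
    simp [sub_eq_add_neg]
  rw [e1, e2]
  ring

end VectorSpaceForms

/-! ### Differential forms and vector fields in charts -/

section ManifoldForms

variable {E : Type*} [NormedAddCommGroup E] [NormedSpace ℝ E] {H : Type*} [TopologicalSpace H]
  {I : ModelWithCorners ℝ E H} [I.Boundaryless] {M : Type*} [TopologicalSpace M]
  [ChartedSpace H M] [IsManifold I ∞ M]

/-- The expression of a vector field in the chart at `x₀`. -/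
noncomputable def VF.inChart (Y : VF I M) (x₀ : M) : E → E := fun y =>
  mfderiv I 𝓘(ℝ, E) (extChartAt I x₀) ((extChartAt I x₀).symm y) (Y ((extChartAt I x₀).symm y))

/-- Smooth differential forms. -/
def Form.IsSmooth {p : ℕ} (α : Form I p M) : Prop :=
  ∀ x₀ : M, ContDiffOn ℝ ∞ (Form.inChart I α x₀) (extChartAt I x₀).target

variable (I) in
omit [IsManifold I ∞ M] in
lemma extChartAt_target_mem_nhds_of_mem {x₀ : M} {y : E} (hy : y ∈ (extChartAt I x₀).target) :
    (extChartAt I x₀).target ∈ 𝓝 y :=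
  (isOpen_extChartAt_target (I := I) x₀).mem_nhds hy

omit [I.Boundaryless] in
lemma mdifferentiableAt_extChartAt_of_mem {x₀ x : M} (hx : x ∈ (extChartAt I x₀).source) :
    MDifferentiableAt I 𝓘(ℝ, E) (extChartAt I x₀) x := by
  have : IsManifold I 1 M := .of_le (n := ∞) (by simp)
  exact mdifferentiableAt_extChartAt (by rwa [extChartAt_source] at hx)

lemma mdifferentiableAt_extChartAt_symm {x₀ : M} {y : E} (hy : y ∈ (extChartAt I x₀).target) :
    MDifferentiableAt 𝓘(ℝ, E) I (extChartAt I x₀).symm y := by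
  have : IsManifold I 1 M := .of_le (n := ∞) (by simp)
  exact (mdifferentiableOn_extChartAt_symm y hy).mdifferentiableAt
    (extChartAt_target_mem_nhds_of_mem I hy)

lemma mfderiv_extChartAt_mfderiv_symm {x₀ : M} {y : E} (hy : y ∈ (extChartAt I x₀).target)
    (v : E) : mfderiv I 𝓘(ℝ, E) (extChartAt I x₀) ((extChartAt I x₀).symm y)
      (mfderiv 𝓘(ℝ, E) I (extChartAt I x₀).symm y v) = v := by
  have : IsManifold I 1 M := .of_le (n := ∞) (by simp)
  have h := mfderiv_extChartAt_comp_mfderivWithin_extChartAt_symm (I := I) hy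
  rw [I.range_eq_univ, mfderivWithin_univ] at h
  exact DFunLike.congr_fun h v

lemma mfderiv_symm_mfderiv_extChartAt {x₀ : M} {y : E} (hy : y ∈ (extChartAt I x₀).target)
    (v : TangentSpace I ((extChartAt I x₀).symm y)) :
    mfderiv 𝓘(ℝ, E) I (extChartAt I x₀).symm y
      (mfderiv I 𝓘(ℝ, E) (extChartAt I x₀) ((extChartAt I x₀).symm y) v) = v := by
  have : IsManifold I 1 M := .of_le (n := ∞) (by simp)
  have h := mfderivWithin_extChartAt_symm_comp_mfderiv_extChartAt (I := I) hy
  rw [I.range_eq_univ, mfderivWithin_univ] at h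
  exact DFunLike.congr_fun h v

lemma mfderiv_extChartAt_symm_self (x : M) (v : E) :
    mfderiv 𝓘(ℝ, E) I (extChartAt I x).symm (extChartAt I x x) v = v := by
  have : IsManifold I 1 M := .of_le (n := ∞) (by simp)
  have h := mfderivWithin_range_extChartAt_symm (I := I) (x := x)
  rw [I.range_eq_univ, mfderivWithin_univ] at h
  exact DFunLike.congr_fun h v

omit [I.Boundaryless] in
lemma mfderiv_extChartAt_self_apply (x : M) (v : E) :
    mfderiv I 𝓘(ℝ, E) (extChartAt I x) x v = v := by
  have : IsManifold I 1 M := .of_le (n := ∞) (by simp)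
  exact DFunLike.congr_fun (mfderiv_extChartAt_self (I := I) (x := x)) v

/-- A form at `x` is its own expression in the chart at `x`. -/
lemma Form.inChart_self {p : ℕ} (α : Form I p M) (x : M) (v : Fin p → E) :
    Form.inChart I α x (extChartAt I x x) v = α x v := by
  have h1 : Form.inChart I α x (extChartAt I x x) v =
      α ((extChartAt I x).symm (extChartAt I x x)) v := by
    refine congrArg (α ((extChartAt I x).symm (extChartAt I x x))) ?_
    funext i
    exact mfderiv_extChartAt_symm_self x (v i)
  rw [h1]
  exact congrArg (fun m : M => (α m : (Fin p → E) → ℝ) v) (extChartAt_to_inv x)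

/-- The value of a form in terms of its expression in any chart. -/
lemma Form.apply_eq_inChart {p : ℕ} (α : Form I p M) {x₀ m : M}
    (hm : m ∈ (extChartAt I x₀).source) (v : Fin p → TangentSpace I m) :
    α m v = Form.inChart I α x₀ (extChartAt I x₀ m) fun i =>
      mfderiv I 𝓘(ℝ, E) (extChartAt I x₀) m (v i) := by
  obtain ⟨y, hy, rfl⟩ : ∃ y ∈ (extChartAt I x₀).target, (extChartAt I x₀).symm y = m :=
    ⟨_, (extChartAt I x₀).map_source hm, (extChartAt I x₀).left_inv hm⟩
  rw [(extChartAt I x₀).right_inv hy]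
  refine congrArg (α ((extChartAt I x₀).symm y)) ?_
  funext i
  exact (mfderiv_symm_mfderiv_extChartAt hy (v i)).symm

lemma Form.ext_inChart {p : ℕ} {α β : Form I p M}
    (h : ∀ x : M, Form.inChart I α x (extChartAt I x x) = Form.inChart I β x (extChartAt I x x)) :
    α = β := by
  funext x
  ext v
  exact (Form.inChart_self α x v).symm.trans
    ((DFunLike.congr_fun (h x) v).trans (Form.inChart_self β x v))

/-- The transition map is smooth. -/
lemma contDiffAt_extChartAt_comp_symm {x₀ x : M} {z : E} (hz : z ∈ (extChartAt I x).target)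
    (hzx : (extChartAt I x).symm z ∈ (extChartAt I x₀).source) :
    ContDiffAt ℝ ∞ (extChartAt I x₀ ∘ (extChartAt I x).symm) z := by
  have h1 : ContMDiffAt 𝓘(ℝ, E) I ∞ (extChartAt I x).symm z :=
    (contMDiffOn_extChartAt_symm x z hz).contMDiffAt (extChartAt_target_mem_nhds_of_mem I hz)
  have h2 : ContMDiffAt I 𝓘(ℝ, E) ∞ (extChartAt I x₀) ((extChartAt I x).symm z) :=
    contMDiffAt_extChartAt' (by rwa [extChartAt_source] at hzx)
  exact (h2.comp z h1).contDiffAt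

lemma fderiv_extChartAt_comp_symm {x₀ x : M} {z : E} (hz : z ∈ (extChartAt I x).target)
    (hzx : (extChartAt I x).symm z ∈ (extChartAt I x₀).source) (v : E) :
    fderiv ℝ (extChartAt I x₀ ∘ (extChartAt I x).symm) z v =
      mfderiv I 𝓘(ℝ, E) (extChartAt I x₀) ((extChartAt I x).symm z)
        (mfderiv 𝓘(ℝ, E) I (extChartAt I x).symm z v) := by
  rw [← mfderiv_eq_fderiv, mfderiv_comp z (mdifferentiableAt_extChartAt_of_mem hzx)
    (mdifferentiableAt_extChartAt_symm hz)]
  rfl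

/-- Change of charts for the expression of a form. -/
lemma Form.inChart_eq_pullback {p : ℕ} (α : Form I p M) {x₀ x : M} {z : E}
    (hz : z ∈ (extChartAt I x).target) (hzx : (extChartAt I x).symm z ∈ (extChartAt I x₀).source) :
    Form.inChart I α x z =
      (Form.inChart I α x₀ ((extChartAt I x₀ ∘ (extChartAt I x).symm) z)).compContinuousLinearMap
        (fderiv ℝ (extChartAt I x₀ ∘ (extChartAt I x).symm) z) := by
  ext v
  refine (Form.apply_eq_inChart α hzx _).trans ?_
  refine congrArg (Form.inChart I α x₀ (extChartAt I x₀ ((extChartAt I x).symm z))) ?_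
  funext i
  exact (fderiv_extChartAt_comp_symm hz hzx (v i)).symm

/-- The exterior derivative may be computed in any chart. -/
theorem inChart_extD {p : ℕ} {α : Form I p M} (hα : Form.IsSmooth α) {x₀ : M} {y : E}
    (hy : y ∈ (extChartAt I x₀).target) :
    Form.inChart I (extD I α) x₀ y = extDeriv (Form.inChart I α x₀) y := by
  set x := (extChartAt I x₀).symm y with hx
  set z := extChartAt I x x with hzdef
  have hz : z ∈ (extChartAt I x).target := mem_extChartAt_target x
  have hxs : x ∈ (extChartAt I x₀).source := (extChartAt I x₀).map_target hy
  have hzx : (extChartAt I x).symm z = x := extChartAt_to_inv x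
  have hzs : (extChartAt I x).symm z ∈ (extChartAt I x₀).source := by
    rw [hzx]; exact hxs
  have hτz : (extChartAt I x₀ ∘ (extChartAt I x).symm) z = y := by
    rw [Function.comp_apply, hzx, hx, (extChartAt I x₀).right_inv hy]
  -- `extD` at `x` is computed in the chart at `x`. There the form is the pull-back, by the
  -- transition map, of its expression at `x₀`, and the exterior derivative commutes with pull-back.
  have hev : Form.inChart I α x =ᶠ[𝓝 z] fun z =>
      (Form.inChart I α x₀ ((extChartAt I x₀ ∘ (extChartAt I x).symm) z)).compContinuousLinearMap
        (fderiv ℝ (extChartAt I x₀ ∘ (extChartAt I x).symm) z) := by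
    have h1 := (continuousAt_extChartAt_symm'' (I := I) hz).eventually_mem
      ((isOpen_extChartAt_source (I := I) x₀).mem_nhds hzs)
    filter_upwards [extChartAt_target_mem_nhds_of_mem I hz, h1] with w hw hw'
    exact Form.inChart_eq_pullback α hw hw'
  have hdiff : DifferentiableAt ℝ (Form.inChart I α x₀)
      ((extChartAt I x₀ ∘ (extChartAt I x).symm) z) := by
    rw [hτz]
    exact ((hα x₀).contDiffAt (extChartAt_target_mem_nhds_of_mem I hy)).differentiableAt (by simp)
  have hpull := extDeriv_pullback hdiff (contDiffAt_extChartAt_comp_symm hz hzs)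
    (by rw [minSmoothness_of_isRCLikeNormedField]; exact WithTop.coe_le_coe.2 le_top)
  ext v
  have h1 : Form.inChart I (extD I α) x₀ y v = extDeriv (Form.inChart I α x) z fun i =>
      mfderiv I 𝓘(ℝ, E) (extChartAt I x) x
        (mfderiv 𝓘(ℝ, E) I (extChartAt I x₀).symm y (v i)) := rfl
  rw [h1, hev.extDeriv_eq, hpull, hτz]
  refine congrArg (extDeriv (Form.inChart I α x₀) y) ?_
  funext i
  refine (fderiv_extChartAt_comp_symm hz hzs _).trans ?_
  refine (congrArg (fun w : E => (mfderiv I 𝓘(ℝ, E) (extChartAt I x₀) ((extChartAt I x).symm z) :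
    E → E) w) ((mfderiv_extChartAt_symm_self (I := I) x _).trans
      (mfderiv_extChartAt_self_apply (I := I) x _))).trans ?_
  refine (congrArg (fun m : M => (mfderiv I 𝓘(ℝ, E) (extChartAt I x₀) m : E → E)
    (mfderiv 𝓘(ℝ, E) I (extChartAt I x₀).symm y (v i))) hzx).trans ?_
  exact mfderiv_extChartAt_mfderiv_symm hy (v i)

lemma Form.IsSmooth.extD {p : ℕ} {α : Form I p M} (hα : Form.IsSmooth α) :
    Form.IsSmooth (extD I α) := fun x₀ =>
  ((hα x₀).extDeriv_of_isOpen (isOpen_extChartAt_target x₀)).congr fun _ hy => inChart_extD hα hy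

lemma inChart_interior {p : ℕ} (Y : VF I M) (α : Form I (p + 1) M) {x₀ : M} {y : E}
    (hy : y ∈ (extChartAt I x₀).target) :
    Form.inChart I (interior I Y α) x₀ y =
      (Form.inChart I α x₀ y).curryLeft (VF.inChart Y x₀ y) := by
  ext v
  refine congrArg (α ((extChartAt I x₀).symm y)) ?_
  funext i
  refine Fin.cases ?_ (fun j => rfl) i
  exact (mfderiv_symm_mfderiv_extChartAt hy _).symm

/-- The chart expression is the pull-back of `Y` by the inverse chart, whose differential is
invertible with inverse the differential of the chart. -/
lemma IsSmoothVF.contDiffOn_inChart [CompleteSpace E] [IsManifold I 1 M] {Y : VF I M}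
    (hY : IsSmoothVF I Y) (x₀ : M) :
    ContDiffOn ℝ ∞ (VF.inChart Y x₀) (extChartAt I x₀).target := by
  have hinv : ∀ y ∈ (extChartAt I x₀).target,
      (mfderiv 𝓘(ℝ, E) I (extChartAt I x₀).symm y).inverse =
        mfderiv I 𝓘(ℝ, E) (extChartAt I x₀) ((extChartAt I x₀).symm y) := fun y hy =>
    ContinuousLinearMap.inverse_eq
      (ContinuousLinearMap.ext fun v => mfderiv_symm_mfderiv_extChartAt hy v)
      (ContinuousLinearMap.ext fun v => mfderiv_extChartAt_mfderiv_symm hy v)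
  intro y hy
  have h1 : ContMDiffAt 𝓘(ℝ, E) I ∞ (extChartAt I x₀).symm y :=
    (contMDiffOn_extChartAt_symm x₀ y hy).contMDiffAt (extChartAt_target_mem_nhds_of_mem I hy)
  have h2 := ContMDiffAt.mpullback_vectorField_preimage (m := ∞) (V := Y)
    (hY.contMDiffAt (x := (extChartAt I x₀).symm y)) h1
    (ContinuousLinearMap.IsInvertible.of_inverse
      (ContinuousLinearMap.ext fun v => mfderiv_symm_mfderiv_extChartAt hy v)
      (ContinuousLinearMap.ext fun v => mfderiv_extChartAt_mfderiv_symm hy v)) (by simp)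
  have h3 := contMDiffAt_vectorSpace_iff_contDiffAt.1 h2
  refine (h3.congr_of_eventuallyEq ?_).contDiffWithinAt
  filter_upwards [extChartAt_target_mem_nhds_of_mem I hy] with w hw
  rw [VectorField.mpullback_apply, hinv w hw]
  rfl

end ManifoldForms

/-! ### Cartan calculus and the Poincaré lemma -/

section CartanCalculus

variable {E : Type*} [NormedAddCommGroup E] [NormedSpace ℝ E] {H : Type*} [TopologicalSpace H]
  {I : ModelWithCorners ℝ E H} [I.Boundaryless] {M : Type*} [TopologicalSpace M]
  [ChartedSpace H M] [IsManifold I ∞ M]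

omit [IsManifold I ∞ M] in
lemma Form.IsSmooth.contDiffAt {p : ℕ} {α : Form I p M} (hα : Form.IsSmooth α) {x₀ : M} {y : E}
    (hy : y ∈ (extChartAt I x₀).target) : ContDiffAt ℝ ∞ (Form.inChart I α x₀) y :=
  (hα x₀).contDiffAt (extChartAt_target_mem_nhds_of_mem I hy)

omit [IsManifold I ∞ M] in
lemma Form.IsSmooth.differentiableAt {p : ℕ} {α : Form I p M} (hα : Form.IsSmooth α) {x₀ : M}
    {y : E} (hy : y ∈ (extChartAt I x₀).target) :
    DifferentiableAt ℝ (Form.inChart I α x₀) y :=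
  (hα.contDiffAt hy).differentiableAt (by simp)

omit [I.Boundaryless] [IsManifold I ∞ M] in
lemma Form.IsSmooth.add {p : ℕ} {α β : Form I p M} (hα : Form.IsSmooth α)
    (hβ : Form.IsSmooth β) : Form.IsSmooth (α + β) := fun x₀ => (hα x₀).add (hβ x₀)

omit [I.Boundaryless] [IsManifold I ∞ M] in
lemma Form.IsSmooth.neg {p : ℕ} {α : Form I p M} (hα : Form.IsSmooth α) :
    Form.IsSmooth (-α) := fun x₀ => (hα x₀).neg

lemma extD_add {p : ℕ} {α β : Form I p M} (hα : Form.IsSmooth α) (hβ : Form.IsSmooth β) :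
    extD I (α + β) = extD I α + extD I β := by
  refine Form.ext_inChart fun x => ?_
  have hy := mem_extChartAt_target (I := I) x
  rw [inChart_extD (hα.add hβ) hy]
  refine (extDeriv_add (hα.differentiableAt hy) (hβ.differentiableAt hy)).trans ?_
  rw [← inChart_extD hα hy, ← inChart_extD hβ hy]
  rfl

lemma extD_neg {p : ℕ} {α : Form I p M} (hα : Form.IsSmooth α) :
    extD I (-α) = -extD I α := by
  refine Form.ext_inChart fun x => ?_
  have hy := mem_extChartAt_target (I := I) x
  rw [inChart_extD hα.neg hy]
  have h := extDeriv_smul (x := extChartAt I x x) (-1 : ℝ) (Form.inChart I α x)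
  have e : (-1 : ℝ) • Form.inChart I α x = Form.inChart I (-α) x := by
    funext z
    exact neg_one_smul ℝ (Form.inChart I α x z)
  rw [e, ← inChart_extD hα hy, neg_one_smul] at h
  exact h

lemma extD_extD {p : ℕ} {α : Form I p M} (hα : Form.IsSmooth α) : extD I (extD I α) = 0 := by
  refine Form.ext_inChart fun x => ?_
  have hy := mem_extChartAt_target (I := I) x
  have hev : Form.inChart I (extD I α) x =ᶠ[𝓝 (extChartAt I x x)]
      extDeriv (Form.inChart I α x) :=
    eventually_of_mem (extChartAt_target_mem_nhds_of_mem I hy) fun z hz => inChart_extD hα hz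
  rw [inChart_extD hα.extD hy, hev.extDeriv_eq, extDeriv_extDeriv_apply (hα.contDiffAt hy)
    (by rw [minSmoothness_of_isRCLikeNormedField]; exact WithTop.coe_le_coe.2 le_top)]
  rfl

lemma Form.IsSmooth.interior [CompleteSpace E] [IsManifold I 1 M] {p : ℕ} {Y : VF I M}
    {α : Form I (p + 1) M} (hY : IsSmoothVF I Y) (hα : Form.IsSmooth α) :
    Form.IsSmooth (interior I Y α) := fun x₀ =>
  ((hα x₀).curryLeft_apply (hY.contDiffOn_inChart x₀)).congr fun _ hy => inChart_interior Y α hy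

lemma Form.IsSmooth.lieForm [CompleteSpace E] [IsManifold I 1 M] {p : ℕ} {Y : VF I M}
    {α : Form I (p + 1) M} (hY : IsSmoothVF I Y) (hα : Form.IsSmooth α) :
    Form.IsSmooth (lieForm I Y α) :=
  (hα.interior hY).extD.add (hα.extD.interior hY)

lemma Form.IsSmooth.lieForm_iterate [CompleteSpace E] [IsManifold I 1 M] {p : ℕ} {Y : VF I M}
    {α : Form I (p + 1) M} (hY : IsSmoothVF I Y) (hα : Form.IsSmooth α) (m : ℕ) :
    Form.IsSmooth ((KSymplectic.lieForm I Y)^[m] α) := by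
  induction m with
  | zero => exact hα
  | succ m ih => rw [Function.iterate_succ_apply']; exact ih.lieForm hY

omit [I.Boundaryless] [IsManifold I ∞ M] in
lemma interior_add {p : ℕ} (Y : VF I M) (α β : Form I (p + 1) M) :
    interior I Y (α + β) = interior I Y α + interior I Y β := rfl

omit [I.Boundaryless] [IsManifold I ∞ M] in
lemma interior_neg {p : ℕ} (Y : VF I M) (α : Form I (p + 1) M) :
    interior I Y (-α) = -interior I Y α := rfl

omit [I.Boundaryless] [IsManifold I ∞ M] in
lemma interior_zero {p : ℕ} (Y : VF I M) : interior I Y (0 : Form I (p + 1) M) = 0 := rfl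

lemma lieForm_add [CompleteSpace E] [IsManifold I 1 M] {p : ℕ} {Y : VF I M}
    {α β : Form I (p + 1) M} (hY : IsSmoothVF I Y) (hα : Form.IsSmooth α)
    (hβ : Form.IsSmooth β) : lieForm I Y (α + β) = lieForm I Y α + lieForm I Y β := by
  unfold lieForm
  rw [interior_add, extD_add (hα.interior hY) (hβ.interior hY), extD_add hα hβ, interior_add]
  abel

lemma lieForm_neg [CompleteSpace E] [IsManifold I 1 M] {p : ℕ} {Y : VF I M}
    {α : Form I (p + 1) M} (hY : IsSmoothVF I Y) (hα : Form.IsSmooth α) :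
    lieForm I Y (-α) = -lieForm I Y α := by
  unfold lieForm
  rw [interior_neg, extD_neg (hα.interior hY), extD_neg hα, interior_neg]
  abel

lemma lieForm_iterate_sub [CompleteSpace E] [IsManifold I 1 M] {p : ℕ} {Y : VF I M}
    {α β : Form I (p + 1) M} (hY : IsSmoothVF I Y) (hα : Form.IsSmooth α)
    (hβ : Form.IsSmooth β) (m : ℕ) :
    (lieForm I Y)^[m] (α - β) = (lieForm I Y)^[m] α - (lieForm I Y)^[m] β := by
  induction m with
  | zero => rfl
  | succ m ih =>
    rw [Function.iterate_succ_apply', ih, Function.iterate_succ_apply',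
      Function.iterate_succ_apply', sub_eq_add_neg,
      lieForm_add hY (hα.lieForm_iterate hY m) (hβ.lieForm_iterate hY m).neg,
      lieForm_neg hY (hβ.lieForm_iterate hY m), sub_eq_add_neg]

lemma lieForm_iterate_neg [CompleteSpace E] [IsManifold I 1 M] {p : ℕ} {Y : VF I M}
    {α : Form I (p + 1) M} (hY : IsSmoothVF I Y) (hα : Form.IsSmooth α) (m : ℕ) :
    (lieForm I Y)^[m] (-α) = -(lieForm I Y)^[m] α := by
  induction m with
  | zero => rfl
  | succ m ih =>
    rw [Function.iterate_succ_apply', ih, Function.iterate_succ_apply',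
      lieForm_neg hY (hα.lieForm_iterate hY m)]

/-- The exterior derivative commutes with Lie derivatives. -/
lemma extD_lieForm [CompleteSpace E] [IsManifold I 1 M] {p : ℕ} {Y : VF I M}
    {α : Form I (p + 1) M} (hY : IsSmoothVF I Y) (hα : Form.IsSmooth α) :
    extD I (lieForm I Y α) = lieForm I Y (extD I α) := by
  unfold lieForm
  rw [extD_add (hα.interior hY).extD (hα.extD.interior hY), extD_extD (hα.interior hY), zero_add,
    extD_extD hα, interior_zero, add_zero]

lemma extD_lieForm_iterate [CompleteSpace E] [IsManifold I 1 M] {p : ℕ} {Y : VF I M}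
    {α : Form I (p + 1) M} (hY : IsSmoothVF I Y) (hα : Form.IsSmooth α) (m : ℕ) :
    extD I ((lieForm I Y)^[m] α) = (lieForm I Y)^[m] (extD I α) := by
  induction m with
  | zero => rfl
  | succ m ih =>
    rw [Function.iterate_succ_apply', extD_lieForm hY (hα.lieForm_iterate hY m), ih,
      Function.iterate_succ_apply']

/-! ### Functions -/

/-- A function as a form of degree zero. -/
noncomputable def zeroForm (f : M → ℝ) : Form I 0 M := fun x =>
  ContinuousAlternatingMap.constOfIsEmpty ℝ (TangentSpace I x) (Fin 0) (f x)

omit [I.Boundaryless] in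
lemma contDiffOn_comp_extChartAt_symm {f : M → ℝ}
    (hf : ContMDiff I 𝓘(ℝ, ℝ) ∞ f) (x₀ : M) :
    ContDiffOn ℝ ∞ (f ∘ (extChartAt I x₀).symm) (extChartAt I x₀).target :=
  (hf.comp_contMDiffOn (contMDiffOn_extChartAt_symm x₀)).contDiffOn

omit [I.Boundaryless] in
lemma contMDiffAt_of_contDiffAt_comp_symm {f : M → ℝ} {x₀ x : M}
    (hx : x ∈ (extChartAt I x₀).source)
    (hf : ContDiffAt ℝ ∞ (f ∘ (extChartAt I x₀).symm) (extChartAt I x₀ x)) :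
    ContMDiffAt I 𝓘(ℝ, ℝ) ∞ f x := by
  have h1 : ContMDiffAt I 𝓘(ℝ, E) ∞ (extChartAt I x₀) x :=
    contMDiffAt_extChartAt' (by rwa [extChartAt_source] at hx)
  refine (hf.contMDiffAt.comp x h1).congr_of_eventuallyEq ?_
  filter_upwards [(isOpen_extChartAt_source (I := I) x₀).mem_nhds hx] with z hz
  simp only [Function.comp_apply, (extChartAt I x₀).left_inv hz]

omit [I.Boundaryless] in
lemma zeroForm_isSmooth {f : M → ℝ} (hf : ContMDiff I 𝓘(ℝ, ℝ) ∞ f) :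
    Form.IsSmooth (zeroForm (I := I) f) := fun x₀ =>
  (ContinuousAlternatingMap.constOfIsEmptyLIE ℝ E ℝ (Fin 0)).contDiff.comp_contDiffOn
    (contDiffOn_comp_extChartAt_symm hf x₀)

lemma Form.IsSmooth.contMDiff_apply {β : Form I 0 M} (hβ : Form.IsSmooth β) :
    ContMDiff I 𝓘(ℝ, ℝ) ∞ (fun x => β x ![]) := fun x => by
  refine contMDiffAt_of_contDiffAt_comp_symm (mem_extChartAt_source x) ?_
  have h := hβ.contDiffAt (mem_extChartAt_target (I := I) x)
  have h2 := (ContinuousAlternatingMap.constOfIsEmptyLIE ℝ E ℝ (Fin 0)).symm.contDiff.contDiffAt.comp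
    _ h (n := ∞)
  refine h2.congr_of_eventuallyEq (Eventually.of_forall fun z => ?_)
  refine congrArg (β ((extChartAt I x).symm z)) ?_
  exact Subsingleton.elim _ _

lemma fderiv_comp_extChartAt_symm {f : M → ℝ} {x₀ : M} {y : E}
    (hy : y ∈ (extChartAt I x₀).target)
    (hf : MDifferentiableAt I 𝓘(ℝ, ℝ) f ((extChartAt I x₀).symm y)) (v : E) :
    fderiv ℝ (f ∘ (extChartAt I x₀).symm) y v =
      mfderiv I 𝓘(ℝ, ℝ) f ((extChartAt I x₀).symm y)
        (mfderiv 𝓘(ℝ, E) I (extChartAt I x₀).symm y v) := by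
  rw [← mfderiv_eq_fderiv, mfderiv_comp y hf (mdifferentiableAt_extChartAt_symm hy)]
  rfl

lemma inChart_dFun_apply {f : M → ℝ} {x₀ : M} {y : E}
    (hy : y ∈ (extChartAt I x₀).target)
    (hf : MDifferentiableAt I 𝓘(ℝ, ℝ) f ((extChartAt I x₀).symm y)) (v : Fin 1 → E) :
    Form.inChart I (dFun I f) x₀ y v = fderiv ℝ (f ∘ (extChartAt I x₀).symm) y (v 0) :=
  (fderiv_comp_extChartAt_symm hy hf (v 0)).symm

lemma extD_eq_dFun {β : Form I 0 M} (hβ : Form.IsSmooth β) :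
    extD I β = dFun I fun x => β x ![] := by
  refine Form.ext_inChart fun x => ?_
  have hy := mem_extChartAt_target (I := I) x
  ext v
  rw [inChart_extD hβ hy, inChart_dFun_apply hy
    (hβ.contMDiff_apply.mdifferentiableAt (by simp)), extDeriv_apply (hβ.differentiableAt hy),
    Fin.sum_univ_one]
  simp only [Fin.val_zero, pow_zero, one_smul]
  refine congrArg (fun g : E → ℝ => fderiv ℝ g (extChartAt I x x) (v 0)) ?_
  funext z
  refine congrArg (β ((extChartAt I x).symm z)) ?_
  exact Subsingleton.elim _ _

lemma extD_zeroForm {f : M → ℝ} (hf : ContMDiff I 𝓘(ℝ, ℝ) ∞ f) :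
    extD I (zeroForm (I := I) f) = dFun I f :=
  extD_eq_dFun (zeroForm_isSmooth hf)

lemma dFun_isSmooth {f : M → ℝ} (hf : ContMDiff I 𝓘(ℝ, ℝ) ∞ f) : Form.IsSmooth (dFun I f) := by
  rw [← extD_zeroForm hf]
  exact (zeroForm_isSmooth hf).extD

lemma extD_dFun {f : M → ℝ} (hf : ContMDiff I 𝓘(ℝ, ℝ) ∞ f) : extD I (dFun I f) = 0 := by
  rw [← extD_zeroForm hf]
  exact extD_extD (zeroForm_isSmooth hf)

omit [I.Boundaryless] [IsManifold I ∞ M] in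
lemma interior_apply_nil (Y : VF I M) (α : Form I 1 M) :
    (fun x => interior I Y α x ![]) = contract I Y α := by
  funext x
  refine congrArg (α x) ?_
  funext i
  fin_cases i
  rfl

lemma Form.IsSmooth.contract [CompleteSpace E] [IsManifold I 1 M] {Y : VF I M}
    {α : Form I 1 M} (hY : IsSmoothVF I Y) (hα : Form.IsSmooth α) :
    ContMDiff I 𝓘(ℝ, ℝ) ∞ (contract I Y α) :=
  interior_apply_nil Y α ▸ (hα.interior hY).contMDiff_apply

lemma extD_interior_eq_dFun [CompleteSpace E] [IsManifold I 1 M] {Y : VF I M}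
    {α : Form I 1 M} (hY : IsSmoothVF I Y) (hα : Form.IsSmooth α) :
    extD I (interior I Y α) = dFun I (contract I Y α) := by
  rw [extD_eq_dFun (hα.interior hY), interior_apply_nil]

omit [I.Boundaryless] [IsManifold I ∞ M] in
lemma contract_dFun (Y : VF I M) (f : M → ℝ) : contract I Y (dFun I f) = lieFun I Y f := rfl

lemma contMDiff_lieFun [CompleteSpace E] [IsManifold I 1 M] {Y : VF I M} (hY : IsSmoothVF I Y)
    {f : M → ℝ} (hf : ContMDiff I 𝓘(ℝ, ℝ) ∞ f) : ContMDiff I 𝓘(ℝ, ℝ) ∞ (lieFun I Y f) :=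
  (dFun_isSmooth hf).contract hY

lemma contMDiff_lieFun_iterate [CompleteSpace E] [IsManifold I 1 M] {Y : VF I M}
    (hY : IsSmoothVF I Y) {f : M → ℝ} (hf : ContMDiff I 𝓘(ℝ, ℝ) ∞ f) (m : ℕ) :
    ContMDiff I 𝓘(ℝ, ℝ) ∞ ((lieFun I Y)^[m] f) := by
  induction m with
  | zero => exact hf
  | succ m ih => rw [Function.iterate_succ_apply']; exact contMDiff_lieFun hY ih

/-- The differential commutes with Lie derivatives. -/
lemma lieForm_iterate_dFun [CompleteSpace E] [IsManifold I 1 M] {Y : VF I M}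
    (hY : IsSmoothVF I Y) {f : M → ℝ} (hf : ContMDiff I 𝓘(ℝ, ℝ) ∞ f) (m : ℕ) :
    (lieForm I Y)^[m] (dFun I f) = dFun I ((lieFun I Y)^[m] f) := by
  induction m with
  | zero => rfl
  | succ m ih =>
    have h := contMDiff_lieFun_iterate hY hf m
    rw [Function.iterate_succ_apply', ih, Function.iterate_succ_apply']
    unfold lieForm
    rw [extD_interior_eq_dFun hY (dFun_isSmooth h), extD_dFun h, interior_zero, add_zero,
      contract_dFun]

/-- The Lie derivative of a `1`-form in a chart. -/
lemma inChart_lieForm_apply [CompleteSpace E] [IsManifold I 1 M] {Y : VF I M}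
    {α : Form I 1 M} (hY : IsSmoothVF I Y) (hα : Form.IsSmooth α) {x₀ : M} {y : E}
    (hy : y ∈ (extChartAt I x₀).target) (v : E) :
    Form.inChart I (lieForm I Y α) x₀ y ![v] =
      fderiv ℝ (Form.inChart I α x₀) y (VF.inChart Y x₀ y) ![v] +
        Form.inChart I α x₀ y ![fderiv ℝ (VF.inChart Y x₀) y v] := by
  have hYd : DifferentiableAt ℝ (VF.inChart Y x₀) y :=
    ((hY.contDiffOn_inChart x₀).contDiffAt
      (extChartAt_target_mem_nhds_of_mem I hy)).differentiableAt (by simp)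
  rw [← extDeriv_curryLeft_add_curryLeft_extDeriv_apply (hα.differentiableAt hy) hYd]
  have hev : Form.inChart I (interior I Y α) x₀ =ᶠ[𝓝 y]
      fun y => (Form.inChart I α x₀ y).curryLeft (VF.inChart Y x₀ y) :=
    eventually_of_mem (extChartAt_target_mem_nhds_of_mem I hy) fun z hz => inChart_interior Y α hz
  rw [← hev.extDeriv_eq, ← inChart_extD (hα.interior hY) hy, ← inChart_extD hα hy,
    ← inChart_interior Y _ hy]
  rfl

/-- Closed `1`-forms are locally exact. -/
theorem exists_dFun_eq_of_extD_eq_zero {α : Form I 1 M} (hα : Form.IsSmooth α)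
    (hd : extD I α = 0) (x₀ : M) : ∃ U : Set M, IsOpen U ∧ x₀ ∈ U ∧ ∃ ξ : M → ℝ,
      ContMDiffOn I 𝓘(ℝ, ℝ) ∞ ξ U ∧ ∀ x ∈ U, α x = dFun I ξ x := by
  set c := extChartAt I x₀ with hc
  obtain ⟨r, hr, hrt⟩ := Metric.mem_nhds_iff.1
    (extChartAt_target_mem_nhds_of_mem I (mem_extChartAt_target (I := I) x₀))
  set B := Metric.ball (extChartAt I x₀ x₀) r with hB
  set a : E → E →L[ℝ] ℝ := fun y =>
    (ContinuousAlternatingMap.ofSubsingletonLIE (𝕜 := ℝ) (E := E) (F := ℝ) (0 : Fin 1)).symm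
      (Form.inChart I α x₀ y) with ha
  have haC : ContDiffOn ℝ ∞ a B :=
    ((ContinuousAlternatingMap.ofSubsingletonLIE (𝕜 := ℝ) (E := E) (F := ℝ)
      (0 : Fin 1)).symm.contDiff.comp_contDiffOn (hα x₀)).mono hrt
  have hav : ∀ y v, a y v = Form.inChart I α x₀ y ![v] := by
    intro y v
    refine congrArg (Form.inChart I α x₀ y) ?_
    funext i
    fin_cases i
    rfl
  have had : DifferentiableOn ℝ a B := haC.differentiableOn (by simp)
  -- For the covector field `a`, closedness of `α` is symmetry of the derivative, which on a ball
  -- suffices for a primitive.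
  have hsymm : ∀ y ∈ B, ∀ v w, fderiv ℝ a y v w = fderiv ℝ a y w v := by
    intro y hy v w
    have hyt := hrt hy
    have h0 : extDeriv (Form.inChart I α x₀) y = 0 := by
      rw [← inChart_extD hα hyt, hd]; rfl
    have key : ∀ v w, fderiv ℝ a y v w = fderiv ℝ (Form.inChart I α x₀) y v ![w] := by
      intro v w
      have h1 := fderiv_continuousAlternatingMap_apply_const_apply (hα.differentiableAt hyt)
        ![w] v
      have h2 : HasFDerivAt (fun z => a z w) ((fderiv ℝ a y).flip w) y := by
        have := (had.differentiableAt (Metric.isOpen_ball.mem_nhds hy)).hasFDerivAt.clm_apply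
          (hasFDerivAt_const w y)
        simpa using this
      have h3 : (fun z => a z w) = fun z => Form.inChart I α x₀ z ![w] := by
        funext z; exact hav z w
      rw [h3] at h2
      rw [← h1, h2.fderiv]
      rfl
    have h4 := DFunLike.congr_fun h0 ![v, w]
    have e4 : Fin.removeNth 0 ![v, w] = ![w] := by funext i; fin_cases i; rfl
    have e5 : Fin.removeNth 1 ![v, w] = ![v] := by funext i; fin_cases i; rfl
    rw [extDeriv_apply (hα.differentiableAt hyt), Fin.sum_univ_two, e4, e5,
      fderiv_continuousAlternatingMap_apply_const_apply (hα.differentiableAt hyt),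
      fderiv_continuousAlternatingMap_apply_const_apply (hα.differentiableAt hyt), ← key,
      ← key] at h4
    simp at h4
    linarith
  obtain ⟨f, hf⟩ := (convex_ball _ r).exists_forall_hasFDerivAt_of_fderiv_symmetric
    Metric.isOpen_ball had hsymm
  have hfC : ContDiffOn ℝ ∞ f B := by
    refine (contDiffOn_infty_iff_fderiv_of_isOpen Metric.isOpen_ball).2
      ⟨fun y hy => (hf y hy).differentiableAt.differentiableWithinAt, ?_⟩
    exact haC.congr fun y hy => (hf y hy).fderiv
  refine ⟨c.source ∩ c ⁻¹' B, ?_, ⟨mem_extChartAt_source x₀, Metric.mem_ball_self hr⟩, f ∘ c, ?_,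
    ?_⟩
  · exact (continuousOn_extChartAt x₀).isOpen_inter_preimage (isOpen_extChartAt_source x₀)
      Metric.isOpen_ball
  · exact hfC.contMDiffOn.comp ((contMDiffOn_extChartAt (n := ∞)).mono fun x hx => by
      rw [← extChartAt_source (I := I)]; exact hx.1) fun x hx => hx.2
  · rintro x ⟨hxs, hxB⟩
    ext v
    have h1 := (hf _ hxB).hasMFDerivAt.comp x (mdifferentiableAt_extChartAt_of_mem hxs).hasMFDerivAt
    have h2 : dFun I (f ∘ c) x v = a (c x) (mfderiv I 𝓘(ℝ, E) c x (v 0)) := by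
      have := h1.mfderiv
      exact congrArg (fun L : TangentSpace I x →L[ℝ] ℝ => L (v 0)) this
    refine (Form.apply_eq_inChart α hxs _).trans (Eq.trans ?_ (h2.trans (hav _ _)).symm)
    refine congrArg (Form.inChart I α x₀ (c x)) ?_
    funext i
    fin_cases i
    rfl

end CartanCalculus

/-! ### The canonical forms in natural coordinates -/

section CanonicalForms

variable {d k : ℕ} {Q : Type*} [TopologicalSpace Q] [ChartedSpace (EuclideanSpace ℝ (Fin d)) Q]
  [IsManifold (𝓡 d) ∞ Q]

lemma extChartAt_cov_fst (x₀ m : Cov d k Q) :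
    (extChartAt (covI d k) x₀ m).1 = extChartAt (𝓡 d) x₀.proj m.proj := by
  rw [FiberBundle.extChartAt]
  rfl

/-- The fibre coordinates of a covelocity. -/
lemma extChartAt_cov_snd_apply (x₀ m : Cov d k Q) (v : BaseE d) :
    (extChartAt (covI d k) x₀ m).2 v = (m.2 : TangentSpace (𝓡 d) m.proj →L[ℝ] (Fin k → ℝ))
      ((trivializationAt (BaseE d) (TangentSpace (𝓡 d)) x₀.proj).symmL ℝ m.proj v) := by
  have h : (extChartAt (covI d k) x₀ m).2 =
    (trivializationAt (FibE d k) (fun q : Q => TangentSpace (𝓡 d) q →L[ℝ]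
      Bundle.Trivial Q (Fin k → ℝ) q) x₀.proj m).2 := by
    rw [FiberBundle.extChartAt]
    rfl
  rw [h, hom_trivializationAt_apply]
  simp only [ContinuousLinearMap.inCoordinates]
  have e : (trivializationAt (Fin k → ℝ) (Bundle.Trivial Q (Fin k → ℝ))
      x₀.proj).continuousLinearMapAt ℝ m.proj = ContinuousLinearMap.id ℝ _ :=
    Bundle.Trivial.continuousLinearMapAt_trivialization ℝ Q (Fin k → ℝ) m.proj
  exact DFunLike.congr_fun e _

lemma proj_mem_source {x₀ m : Cov d k Q} (hm : m ∈ (extChartAt (covI d k) x₀).source) :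
    m.proj ∈ (extChartAt (𝓡 d) x₀.proj).source := by
  rw [FiberBundle.extChartAt] at hm
  exact hm.2.1

/-- The canonical forms in natural coordinates. -/
lemma inChart_theta_apply (A : Fin k) {x₀ : Cov d k Q} {y : BaseE d × FibE d k}
    (hy : y ∈ (extChartAt (covI d k) x₀).target) (w : Fin 1 → BaseE d × FibE d k) :
    Form.inChart (covI d k) (theta d k A) x₀ y w = y.2 (w 0).1 A := by
  have hQ : IsManifold (𝓡 d) 1 Q := .of_le (n := ∞) (by simp)
  set c := extChartAt (covI d k) x₀ with hc
  set m := c.symm y with hm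
  have hms : m ∈ c.source := c.map_target hy
  have hq : m.proj ∈ (extChartAt (𝓡 d) x₀.proj).source := proj_mem_source hms
  have hcm : c m = y := c.right_inv hy
  -- The frame defining the fibre coordinates is the differential of the inverse base chart, so
  -- these coordinates are the components of the covectors with respect to `∂/∂q^i`.
  have hsymm := TangentBundle.symmL_trivializationAt (I := 𝓡 d) (x₀ := x₀.proj) (x := m.proj)
    (by rwa [extChartAt_source] at hq)
  rw [(𝓡 d).range_eq_univ, mfderivWithin_univ, ← extChartAt_cov_fst, ← hc, hcm] at hsymm
  have hy1 : y.1 ∈ (extChartAt (𝓡 d) x₀.proj).target := by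
    rw [← hcm, hc, extChartAt_cov_fst]
    exact (extChartAt (𝓡 d) x₀.proj).map_source hq
  -- the projection in coordinates
  have hev : (fun z => (c.symm z).proj) =ᶠ[𝓝 y] (extChartAt (𝓡 d) x₀.proj).symm ∘ Prod.fst := by
    filter_upwards [extChartAt_target_mem_nhds_of_mem (covI d k) hy] with z hz
    have h1 : (c (c.symm z)).1 = z.1 := by rw [c.right_inv hz]
    rw [hc, extChartAt_cov_fst] at h1
    rw [Function.comp_apply, ← h1]
    exact ((extChartAt (𝓡 d) x₀.proj).left_inv (proj_mem_source (c.map_target hz))).symm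
  have hproj : MDifferentiableAt (covI d k) (𝓡 d) (Bundle.TotalSpace.proj : Cov d k Q → Q) m :=
    (Bundle.contMDiff_proj (n := 1) _).mdifferentiableAt (by simp)
  have hd1 : HasMFDerivAt 𝓘(ℝ, BaseE d × FibE d k) (𝓡 d) (fun z => (c.symm z).proj) y
      ((mfderiv (covI d k) (𝓡 d) (Bundle.TotalSpace.proj : Cov d k Q → Q) m).comp
        (mfderiv 𝓘(ℝ, BaseE d × FibE d k) (covI d k) c.symm y)) :=
    hproj.hasMFDerivAt.comp y (mdifferentiableAt_extChartAt_symm hy).hasMFDerivAt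
  have hd2 : HasMFDerivAt 𝓘(ℝ, BaseE d × FibE d k) (𝓡 d)
      ((extChartAt (𝓡 d) x₀.proj).symm ∘ Prod.fst) y
      ((mfderiv 𝓘(ℝ, BaseE d) (𝓡 d) (extChartAt (𝓡 d) x₀.proj).symm y.1).comp
        (ContinuousLinearMap.fst ℝ (BaseE d) (FibE d k))) :=
    (mdifferentiableAt_extChartAt_symm hy1).hasMFDerivAt.comp y
      (hasFDerivAt_fst (𝕜 := ℝ) (p := y)).hasMFDerivAt
  have heq := hasMFDerivAt_unique hd1 (hd2.congr_of_eventuallyEq hev)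
  have h1 : Form.inChart (covI d k) (theta d k A) x₀ y w =
      (m.2 : TangentSpace (𝓡 d) m.proj →L[ℝ] (Fin k → ℝ))
        (((mfderiv (covI d k) (𝓡 d) (Bundle.TotalSpace.proj : Cov d k Q → Q) m).comp
          (mfderiv 𝓘(ℝ, BaseE d × FibE d k) (covI d k) c.symm y)) (w 0)) A := rfl
  rw [h1, heq]
  have h2 := extChartAt_cov_snd_apply x₀ m (w 0).1
  rw [← hc, hcm, hsymm] at h2
  rw [h2]
  rfl

omit [IsManifold (𝓡 d) ∞ Q] in
lemma contDiff_ofSubsingleton_comp {X V W : Type*} [NormedAddCommGroup V] [NormedSpace ℝ V]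
    [NormedAddCommGroup W] [NormedSpace ℝ W] [NormedAddCommGroup X] [NormedSpace ℝ X]
    {a : X → V →L[ℝ] ℝ} (ha : ContDiff ℝ ∞ a) (L : W →L[ℝ] V) : ContDiff ℝ ∞ fun y =>
      ContinuousAlternatingMap.ofSubsingleton ℝ W ℝ (0 : Fin 1) ((a y).comp L) :=
  (ContinuousAlternatingMap.ofSubsingletonLIE (𝕜 := ℝ) (E := W)
    (F := ℝ) (0 : Fin 1)).contDiff.comp (ha.clm_comp contDiff_const)

lemma theta_isSmooth (A : Fin k) : Form.IsSmooth (theta (Q := Q) d k A) := by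
  intro x₀
  have h1 : ContDiff ℝ ∞ fun y : BaseE d × FibE d k =>
      ((ContinuousLinearMap.proj A : (Fin k → ℝ) →L[ℝ] ℝ).comp y.2) :=
    contDiff_const.clm_comp contDiff_snd
  refine (contDiff_ofSubsingleton_comp h1
    (ContinuousLinearMap.fst ℝ (BaseE d) (FibE d k))).contDiffOn.congr fun y hy => ?_
  ext w
  exact inChart_theta_apply A hy w

/-- This is `ω^A = dq^i ∧ dp^A_i`. The chart at `x` has identity differential at `x`, so tangent
vectors there are their own coordinates. -/
lemma omega_apply (A : Fin k) (x : Cov d k Q) (u w : BaseE d × FibE d k) :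
    omega d k A x ![u, w] = w.2 u.1 A - u.2 w.1 A := by
  have hy := mem_extChartAt_target (I := covI d k) x
  have h1 : omega d k A x ![u, w] = -extDeriv (Form.inChart (covI d k) (theta d k A) x)
      (extChartAt (covI d k) x x) ![u, w] := by
    rw [← inChart_extD (theta_isSmooth A) hy]
    exact congrArg Neg.neg (Form.inChart_self (extD (covI d k) (theta d k A)) x ![u, w]).symm
  have hdiff := (theta_isSmooth (Q := Q) A).differentiableAt hy
  have key : ∀ u w : BaseE d × FibE d k, fderiv ℝ (fun z =>
      Form.inChart (covI d k) (theta d k A) x z ![w]) (extChartAt (covI d k) x x) u =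
        u.2 w.1 A := by
    intro u w
    have hev : (fun z => Form.inChart (covI d k) (theta d k A) x z ![w]) =ᶠ[
        𝓝 (extChartAt (covI d k) x x)] fun z => z.2 w.1 A := by
      filter_upwards [extChartAt_target_mem_nhds_of_mem (covI d k) hy] with z hz
      exact inChart_theta_apply A hz _
    have hl : HasFDerivAt (fun z : BaseE d × FibE d k => z.2 w.1 A)
        ((ContinuousLinearMap.proj A : (Fin k → ℝ) →L[ℝ] ℝ).comp
          ((ContinuousLinearMap.apply ℝ (Fin k → ℝ) w.1).comp
            (ContinuousLinearMap.snd ℝ (BaseE d) (FibE d k)))) (extChartAt (covI d k) x x) :=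
      ContinuousLinearMap.hasFDerivAt ((ContinuousLinearMap.proj A : (Fin k → ℝ) →L[ℝ] ℝ).comp
          ((ContinuousLinearMap.apply ℝ (Fin k → ℝ) w.1).comp
            (ContinuousLinearMap.snd ℝ (BaseE d) (FibE d k))))
    rw [hev.fderiv_eq, hl.fderiv]
    rfl
  have e4 : Fin.removeNth 0 ![u, w] = ![w] := by funext i; fin_cases i; rfl
  have e5 : Fin.removeNth 1 ![u, w] = ![u] := by funext i; fin_cases i; rfl
  rw [h1, extDeriv_apply hdiff, Fin.sum_univ_two, e4, e5]
  simp only [Matrix.cons_val_zero, Matrix.cons_val_one]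
  rw [key, key]
  simp only [Fin.val_zero, Fin.val_one, pow_zero, pow_one, one_smul, neg_smul]
  ring

omit [IsManifold (𝓡 d) ∞ Q] in
-- The HDW equations test a linear identity on the coordinate basis. By `omega_apply` the right-hand
-- side is `∑_A ω^A(ξ_A, w)`.
lemma hdw_iff_linear (dH : BaseE d × FibE d k →L[ℝ] ℝ) (ξ : Fin k → BaseE d × FibE d k) :
    ((∀ i : Fin d, dH (EuclideanSpace.single i 1, 0) =
        -∑ A, (ξ A).2 (EuclideanSpace.single i 1) A) ∧
      (∀ (A : Fin k) (i : Fin d),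
        dH (0, (EuclideanSpace.proj i : BaseE d →L[ℝ] ℝ).smulRight (Pi.single A 1)) =
          (ξ A).1 i)) ↔ ∀ w, dH w = ∑ A, (w.2 (ξ A).1 A - (ξ A).2 w.1 A) := by
  constructor
  · rintro ⟨h1, h2⟩ ⟨v, p⟩
    have hv : ∀ v : BaseE d, v = ∑ i, v i • EuclideanSpace.single i (1 : ℝ) := fun v => by
      ext j; simp [Finset.sum_apply, Pi.single_apply]
    have hp : p = ∑ A, ∑ i, p (EuclideanSpace.single i 1) A •
        (EuclideanSpace.proj i : BaseE d →L[ℝ] ℝ).smulRight (Pi.single A (1 : ℝ)) := by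
      ext u B
      conv_lhs => rw [hv u]
      simp [Finset.sum_apply, Pi.single_apply, mul_comm]
    have e : ((v, p) : BaseE d × FibE d k) = (v, 0) + (0, p) := by simp
    have d1 : dH (v, 0) = -∑ A, (ξ A).2 v A := by
      have : ((v, 0) : BaseE d × FibE d k) = ∑ i, v i • (EuclideanSpace.single i (1 : ℝ), 0) := by
        conv_lhs => rw [hv v]
        ext <;> simp [Prod.fst_sum, Prod.snd_sum]
      rw [this, map_sum]
      simp only [map_smul, h1, smul_eq_mul, mul_neg, Finset.mul_sum, Finset.sum_neg_distrib]
      rw [Finset.sum_comm]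
      congr 1
      refine Finset.sum_congr rfl fun A _ => ?_
      conv_rhs => rw [hv v]
      simp [Finset.sum_apply]
    have d2 : dH (0, p) = ∑ A, p (ξ A).1 A := by
      have : ((0, p) : BaseE d × FibE d k) = ∑ A, ∑ i, p (EuclideanSpace.single i 1) A •
          (0, (EuclideanSpace.proj i : BaseE d →L[ℝ] ℝ).smulRight (Pi.single A (1 : ℝ))) := by
        conv_lhs => rw [hp]
        ext <;> simp [Prod.fst_sum, Prod.snd_sum]
      rw [this]
      simp only [map_sum, map_smul, h2, smul_eq_mul]
      refine Finset.sum_congr rfl fun A _ => ?_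
      conv_rhs => rw [hv (ξ A).1]
      simp [Finset.sum_apply, mul_comm]
    rw [e, map_add, d1, d2]
    simp only [Prod.fst_add, Prod.snd_add, add_zero, zero_add, Finset.sum_sub_distrib]
    ring
  · intro h
    refine ⟨fun i => by simp [h], fun A i => ?_⟩
    simp [h, Pi.single_apply]

end CanonicalForms

/-! ### Flows on manifolds, transport of 1-forms, embedded images -/

section LocalFlows

variable {E : Type*} [NormedAddCommGroup E] [NormedSpace ℝ E] {H : Type*} [TopologicalSpace H]
  {I : ModelWithCorners ℝ E H} [I.Boundaryless] {M : Type*} [TopologicalSpace M]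
  [ChartedSpace H M] [IsManifold I ∞ M]

/-- Smooth vector fields have local flows; in a chart, their differentials solve the equation of
variations. -/
theorem exists_isLocalFlow_hasDerivAt_variation [CompleteSpace E] [IsManifold I 1 M] {Y : VF I M}
    (hY : IsSmoothVF I Y) (x₁ : M) : ∃ (V : Set M) (b : ℝ) (α : E → ℝ → E), x₁ ∈ V ∧
      V ⊆ (extChartAt I x₁).source ∧
      IsLocalFlow I Y V b (fun s x => (extChartAt I x₁).symm (α (extChartAt I x₁ x) s)) ∧
      ∀ x ∈ V, α (extChartAt I x₁ x) 0 = extChartAt I x₁ x ∧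
        (∀ s ∈ Ioo (-b) b, α (extChartAt I x₁ x) s ∈ (extChartAt I x₁).target ∧
          HasDerivAt (α (extChartAt I x₁ x))
            (VF.inChart Y x₁ (α (extChartAt I x₁ x) s)) s) ∧
        ∀ v, ∃ w : ℝ → E, w 0 = v ∧ ∀ s ∈ Ioo (-b) b,
          HasDerivAt w (fderiv ℝ (VF.inChart Y x₁) (α (extChartAt I x₁ x) s) (w s)) s ∧
          ∀ γ : ℝ → E, γ 0 = extChartAt I x₁ x → HasDerivAt γ v 0 →
            HasDerivAt (fun τ => α (γ τ) s) (w s) 0 := by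
  set c := extChartAt I x₁ with hc
  have htgt : c.target ∈ 𝓝 (c x₁) :=
    extChartAt_target_mem_nhds_of_mem I (mem_extChartAt_target (I := I) x₁)
  have hf : ContDiffAt ℝ 2 (VF.inChart Y x₁) (c x₁) :=
    ((hY.contDiffOn_inChart x₁).contDiffAt htgt).of_le (WithTop.coe_le_coe.2 le_top)
  obtain ⟨r, hr, b, hb, α, hα⟩ := exists_localFlow_hasDerivAt_variation hf htgt
  refine ⟨c.source ∩ c ⁻¹' Metric.ball (c x₁) r, b, α,
    ⟨mem_extChartAt_source x₁, Metric.mem_ball_self hr⟩, inter_subset_left,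
    ⟨(continuousOn_extChartAt x₁).isOpen_inter_preimage (isOpen_extChartAt_source x₁)
      Metric.isOpen_ball, hb, fun x hx => ?_⟩, fun x hx => hα _ hx.2⟩
  obtain ⟨h0, h1, -⟩ := hα _ hx.2
  refine ⟨by simp only [h0]; exact c.left_inv hx.1, fun s hs => ?_⟩
  obtain ⟨hst, hsd⟩ := h1 s hs
  have h2 := (mdifferentiableAt_extChartAt_symm (I := I) hst).hasMFDerivAt.comp s
    hsd.hasFDerivAt.hasMFDerivAt
  refine HasMFDerivAt.hasMFDerivWithinAt ?_
  refine h2.congr_mfderiv (ContinuousLinearMap.ext fun (τ : ℝ) => ?_)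
  exact (map_smul (mfderiv 𝓘(ℝ, E) I c.symm (α (c x) s)) (τ : ℝ) _).trans
    (congrArg (fun v => τ • v) (mfderiv_symm_mfderiv_extChartAt hst _))

/-- The product rule. When `a' = f(a)` and `w' = f'(a) w`, the derivative is the Lie derivative of
`b` along `f`, in the form of `inChart_lieForm_apply`. -/
lemma hasDerivAt_oneForm_apply {b : E → E [⋀^Fin 1]→L[ℝ] ℝ} {a w : ℝ → E} {a' w' : E} {s : ℝ}
    (hb : DifferentiableAt ℝ b (a s)) (ha : HasDerivAt a a' s) (hw : HasDerivAt w w' s) :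
    HasDerivAt (fun s => b (a s) ![w s])
      (fderiv ℝ b (a s) a' ![w s] + b (a s) ![w']) s := by
  set e := (ContinuousAlternatingMap.ofSubsingletonLIE (𝕜 := ℝ) (E := E) (F := ℝ)
    (0 : Fin 1)).symm
  have h1 : HasDerivAt (fun s => b (a s)) (fderiv ℝ b (a s) a') s :=
    hb.hasFDerivAt.comp_hasDerivAt s ha
  have h2 : HasDerivAt (fun s => e (b (a s))) (e (fderiv ℝ b (a s) a')) s :=
    (e.toContinuousLinearEquiv.toContinuousLinearMap.hasFDerivAt).comp_hasDerivAt s h1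
  have h3 := h2.clm_apply hw
  have he : ∀ (β : E [⋀^Fin 1]→L[ℝ] ℝ) v, e β v = β ![v] := fun β v => by
    refine congrArg β ?_
    funext i
    fin_cases i
    rfl
  simpa only [he] using h3

/-- If the sum of the values of `1`-forms along transported vectors vanishes, so does that of the
values of their Lie derivatives. -/
lemma sum_inChart_iterate_lieForm_eq_zero [CompleteSpace E] [IsManifold I 1 M] {Y : VF I M}
    (hY : IsSmoothVF I Y) {ι : Type*} [Fintype ι] {β : ι → Form I 1 M}
    (hβ : ∀ i, Form.IsSmooth (β i)) {x₁ : M} {T : Set ℝ} (hT : IsOpen T) {a : ℝ → E}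
    {w : ι → ℝ → E} (ha : ∀ s ∈ T, a s ∈ (extChartAt I x₁).target)
    (ha' : ∀ s ∈ T, HasDerivAt a (VF.inChart Y x₁ (a s)) s)
    (hw : ∀ i, ∀ s ∈ T, HasDerivAt (w i) (fderiv ℝ (VF.inChart Y x₁) (a s) (w i s)) s)
    (h0 : ∀ s ∈ T, ∑ i, Form.inChart I (β i) x₁ (a s) ![w i s] = 0) (m : ℕ) :
    ∀ s ∈ T, ∑ i, Form.inChart I ((lieForm I Y)^[m] (β i)) x₁ (a s) ![w i s] = 0 := by
  induction m with
  | zero => exact h0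
  | succ m ih =>
    intro s hs
    -- The sum vanishes for all `s` in the open set `T`, hence so does its derivative, which is the
    -- same sum with one more Lie derivative.
    have h1 := HasDerivAt.fun_sum (u := Finset.univ) fun i _ => hasDerivAt_oneForm_apply
      (((hβ i).lieForm_iterate hY m).differentiableAt (ha s hs)) (ha' s hs) (hw i s hs)
    have h2 : (fun s => ∑ i, Form.inChart I ((lieForm I Y)^[m] (β i)) x₁ (a s) ![w i s]) =ᶠ[𝓝 s]
        fun _ => 0 := eventually_of_mem (hT.mem_nhds hs) ih
    have h3 := h1.unique ((hasDerivAt_const s (0 : ℝ)).congr_of_eventuallyEq h2)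
    rw [← h3]
    refine Finset.sum_congr rfl fun i _ => ?_
    rw [Function.iterate_succ_apply', inChart_lieForm_apply hY ((hβ i).lieForm_iterate hY m)
      (ha s hs)]

/-- An `extChartAt` of a boundaryless manifold as an open partial homeomorphism. -/
noncomputable def extChartHomeo (x₀ : M) : OpenPartialHomeomorph M E where
  toPartialEquiv := extChartAt I x₀
  open_source := isOpen_extChartAt_source x₀
  open_target := isOpen_extChartAt_target x₀
  continuousOn_toFun := continuousOn_extChartAt x₀
  continuousOn_invFun := continuousOn_extChartAt_symm x₀

/-- Every nonempty open set contains a point around which a smooth map has constant rank; arbitrarily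
small neighbourhoods of this point have embedded images. -/
theorem exists_isEmbeddedSubmanifold_image [FiniteDimensional ℝ E] {V : Type*}
    [NormedAddCommGroup V] [NormedSpace ℝ V] [FiniteDimensional ℝ V] {ψ : V → M} {O : Set V}
    (hO : IsOpen O) (hψ : ContMDiffOn 𝓘(ℝ, V) I ∞ ψ O) (hne : O.Nonempty) :
    ∃ t₁ ∈ O, ∀ N ∈ 𝓝 t₁, ∃ D, IsOpen D ∧ t₁ ∈ D ∧ D ⊆ O ∩ N ∧
      IsEmbeddedSubmanifold I (ψ '' D) := by
  obtain ⟨t₀, ht₀⟩ := hne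
  set c := extChartAt I (ψ t₀) with hc
  set O₁ := O ∩ ψ ⁻¹' c.source with hO₁
  have hO₁o : IsOpen O₁ :=
    hψ.continuousOn.isOpen_inter_preimage hO (isOpen_extChartAt_source _)
  have hf : ContDiffOn ℝ ∞ (c ∘ ψ) O₁ :=
    ((contMDiffOn_extChartAt (I := I) (x := ψ t₀) (n := ∞)).comp (hψ.mono inter_subset_left)
      (fun t ht => by have h := ht.2; rwa [hc, mem_preimage, extChartAt_source] at h)).contDiffOn
  set rk : V → ℕ := fun t => Module.finrank ℝ (LinearMap.range (fderiv ℝ (c ∘ ψ) t : V →ₗ[ℝ] E))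
    with hrk
  have hrk_le : ∀ t, rk t ≤ Module.finrank ℝ V := fun t => LinearMap.finrank_range_le _
  -- The rank is bounded by `dim V`, so it attains a maximum on `O₁`; this maximality survives
  -- shrinking to any neighbourhood `N`.
  obtain ⟨t₁, ht₁, hmin⟩ := (measure fun t => Module.finrank ℝ V - rk t).wf.has_min O₁
    ⟨t₀, ht₀, mem_extChartAt_source _⟩
  have hmax : ∀ t ∈ O₁, rk t ≤ rk t₁ := fun t ht => by
    have h1 : ¬ (Module.finrank ℝ V - rk t < Module.finrank ℝ V - rk t₁) := hmin t ht
    have := hrk_le t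
    have := hrk_le t₁
    omega
  refine ⟨t₁, ht₁.1, fun N hN => ?_⟩
  obtain ⟨D, Θ, W, hD, ht₁D, hDO, hΘ, hΘs, hDW⟩ := exists_image_eventually_mem_iff
    (hO₁o.inter isOpen_interior) (hf.mono (inter_subset_left (t := _root_.interior N)))
    ⟨ht₁, mem_interior_iff_mem_nhds.2 hN⟩ fun t ht => hmax t ht.1
  refine ⟨D, hD, ht₁D, fun t ht => ⟨(hDO ht).1.1, interior_subset (hDO ht).2⟩,
    Module.finrank ℝ W, ?_⟩
  rintro _ ⟨t, ht, rfl⟩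
  obtain ⟨hxt, hxe⟩ := hDW _ (mem_image_of_mem (c ∘ ψ) ht)
  have hsrc : ∀ t ∈ D, ψ t ∈ c.source := fun t ht => (hDO ht).1.2
  have hcs : ContMDiffOn I 𝓘(ℝ, E) ∞ c c.source := by
    rw [hc, extChartAt_source]
    exact contMDiffOn_extChartAt
  refine ⟨(extChartHomeo (I := I) (ψ t₀)).trans Θ.symm, W, ⟨hsrc t ht, hxt⟩, ?_, ?_, rfl, ?_⟩
  · exact hΘs.contMDiffOn.comp (hcs.mono inter_subset_left) fun x hx => hx.2
  · exact (contMDiffOn_extChartAt_symm (ψ t₀)).comp (hΘ.contMDiffOn.mono fun x hx => hx.1)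
      fun x hx => hx.2
  · have h1 : ContinuousAt c (ψ t) :=
      (continuousOn_extChartAt _).continuousAt
        ((isOpen_extChartAt_source _).mem_nhds (hsrc t ht))
    filter_upwards [h1.eventually hxe,
      (isOpen_extChartAt_source (I := I) (ψ t₀)).mem_nhds (hsrc t ht)] with y hy hys
    refine Iff.trans ?_ hy
    constructor
    · rintro ⟨u, hu, rfl⟩
      exact ⟨u, hu, rfl⟩
    · rintro ⟨u, hu, hue⟩
      exact ⟨u, hu, c.injOn (hsrc u hu) hys hue⟩

end LocalFlows

/-! ### Partial derivatives of maps into a manifold -/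

section PartialDerivatives

variable {E : Type*} [NormedAddCommGroup E] [NormedSpace ℝ E] {H : Type*} [TopologicalSpace H]
  {I : ModelWithCorners ℝ E H} [I.Boundaryless] {M : Type*} [TopologicalSpace M]
  [ChartedSpace H M] [IsManifold I ∞ M] {k : ℕ}

omit [I.Boundaryless] in
lemma partialD_eq_fderiv {ψ : (Fin k → ℝ) → M} {t : Fin k → ℝ}
    (hψ : MDifferentiableAt 𝓘(ℝ, Fin k → ℝ) I ψ t) (A : Fin k) :
    partialD I ψ t A = fderiv ℝ (extChartAt I (ψ t) ∘ ψ) t (Pi.single A 1) := by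
  have h := (mdifferentiableAt_extChartAt_of_mem
    (mem_extChartAt_source (I := I) (ψ t))).hasMFDerivAt.comp t hψ.hasMFDerivAt
  rw [← mfderiv_eq_fderiv, h.mfderiv]
  exact (mfderiv_extChartAt_self_apply (E := E) (I := I) (ψ t) (partialD I ψ t A)).symm

omit [I.Boundaryless] in
-- Provides the curves of initial points, with velocity `∂_A ψ` in the chart, to which the equation
-- of variations is applied.
lemma mfderiv_extChartAt_partialD {x₁ : M} {ψ : (Fin k → ℝ) → M} {t : Fin k → ℝ}
    (hψ : MDifferentiableAt 𝓘(ℝ, Fin k → ℝ) I ψ t) (ht : ψ t ∈ (extChartAt I x₁).source)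
    (A : Fin k) : HasDerivAt (fun τ : ℝ => extChartAt I x₁ (ψ (t + τ • Pi.single A 1)))
      (mfderiv I 𝓘(ℝ, E) (extChartAt I x₁) (ψ t) (partialD I ψ t A)) 0 := by
  have h1 := (mdifferentiableAt_extChartAt_of_mem ht).hasMFDerivAt.comp t hψ.hasMFDerivAt
  exact h1.hasFDerivAt.hasLineDerivAt (Pi.single A 1)

omit [I.Boundaryless] [IsManifold I ∞ M] in
lemma fderiv_comp_eq_dFun_partialD {g : M → ℝ} {ψ : (Fin k → ℝ) → M} {t : Fin k → ℝ}
    (hg : MDifferentiableAt I 𝓘(ℝ, ℝ) g (ψ t)) (hψ : MDifferentiableAt 𝓘(ℝ, Fin k → ℝ) I ψ t)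
    (A : Fin k) : fderiv ℝ (g ∘ ψ) t (Pi.single A 1) = dFun I g (ψ t) ![partialD I ψ t A] := by
  rw [← mfderiv_eq_fderiv, mfderiv_comp t hg hψ]
  rfl

lemma fderiv_comp_extChartAt_symm_self {f : M → ℝ} {x : M}
    (hf : MDifferentiableAt I 𝓘(ℝ, ℝ) f x) (v : E) :
    fderiv ℝ (f ∘ (extChartAt I x).symm) (extChartAt I x x) v = mfderiv I 𝓘(ℝ, ℝ) f x v := by
  rw [← extChartAt_to_inv (I := I) x] at hf
  exact (inChart_dFun_apply (mem_extChartAt_target x) hf ![v]).symm.trans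
    (Form.inChart_self (dFun I f) x ![v])

end PartialDerivatives

/-! ### Conservation along solutions -/

section Noether

variable {d k : ℕ} {Q : Type*} [TopologicalSpace Q] [ChartedSpace (EuclideanSpace ℝ (Fin d)) Q]
  [IsManifold (𝓡 d) ∞ Q] {Ham : Cov d k Q → ℝ}

/-- The Hamilton-de Donder-Weyl equations read `∑_A i(∂_A ψ) ω^A = dH`. -/
theorem isHDWSolution_iff (hHam : ContMDiff (covI d k) 𝓘(ℝ, ℝ) ∞ Ham) {D : Set (Fin k → ℝ)}
    {ψ : (Fin k → ℝ) → Cov d k Q} : IsHDWSolution d k Ham D ψ ↔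
      IsOpen D ∧ ContMDiffOn 𝓘(ℝ, Fin k → ℝ) (covI d k) ∞ ψ D ∧
        ∀ t ∈ D, ∀ w : BaseE d × FibE d k, mfderiv (covI d k) 𝓘(ℝ, ℝ) Ham (ψ t) w =
          ∑ A, omega d k A (ψ t) ![partialD (covI d k) ψ t A, w] := by
  refine and_congr_right fun hD => and_congr_right fun hψ => forall₂_congr fun t ht => ?_
  have hψt : MDifferentiableAt 𝓘(ℝ, Fin k → ℝ) (covI d k) ψ t :=
    (hψ.contMDiffAt (hD.mem_nhds ht)).mdifferentiableAt (by simp)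
  refine (hdw_iff_linear _ fun A => fderiv ℝ (extChartAt (covI d k) (ψ t) ∘ ψ) t
    (Pi.single A 1)).trans (forall_congr' fun w => ?_)
  rw [fderiv_comp_extChartAt_symm_self (hHam.mdifferentiableAt (by simp))]
  refine Eq.congr_right (Finset.sum_congr rfl fun A _ => ?_)
  refine (omega_apply A (ψ t) _ w).symm.trans ?_
  refine congrArg (fun u => omega d k A (ψ t) ![u, w]) (partialD_eq_fderiv hψt A).symm

lemma IsHDWSolution.mono {D D' : Set (Fin k → ℝ)} {ψ : (Fin k → ℝ) → Cov d k Q}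
    (h : IsHDWSolution d k Ham D ψ) (hD' : IsOpen D') (hDD' : D' ⊆ D) :
    IsHDWSolution d k Ham D' ψ :=
  ⟨hD', h.2.1.mono hDD', fun t ht => h.2.2 t (hDD' ht)⟩

lemma IsHDWSolution.mdifferentiableAt {D : Set (Fin k → ℝ)} {ψ : (Fin k → ℝ) → Cov d k Q}
    (h : IsHDWSolution d k Ham D ψ) {t : Fin k → ℝ} (ht : t ∈ D) :
    MDifferentiableAt 𝓘(ℝ, Fin k → ℝ) (covI d k) ψ t :=
  (h.2.1.contMDiffAt (h.1.mem_nhds ht)).mdifferentiableAt (by simp)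

lemma omega_eq_neg_extD (A : Fin k) :
    omega (Q := Q) d k A = -extD (covI d k) (theta (Q := Q) d k A) := rfl

lemma omega_isSmooth (A : Fin k) : Form.IsSmooth (omega (Q := Q) d k A) :=
  (theta_isSmooth A).extD.neg

/-- Along a solution, `∑_A i(∂_A ψ) i(Y) ω^A = -L(Y)H`. -/
lemma IsHDWSolution.sum_interior_omega_partialD (hHam : ContMDiff (covI d k) 𝓘(ℝ, ℝ) ∞ Ham)
    {D : Set (Fin k → ℝ)} {ψ : (Fin k → ℝ) → Cov d k Q} (h : IsHDWSolution d k Ham D ψ)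
    {t : Fin k → ℝ} (ht : t ∈ D) (Y : VF (covI d k) (Cov d k Q)) :
    ∑ A, interior (covI d k) Y (omega d k A) (ψ t) ![partialD (covI d k) ψ t A] =
      -lieFun (covI d k) Y Ham (ψ t) := by
  have h1 := ((isHDWSolution_iff hHam).1 h).2.2 t ht (Y (ψ t))
  refine Eq.trans ?_ (congrArg Neg.neg h1.symm)
  rw [← Finset.sum_neg_distrib]
  refine Finset.sum_congr rfl fun A _ => ?_
  have e : interior (covI d k) Y (omega d k A) (ψ t) ![partialD (covI d k) ψ t A] =
      omega d k A (ψ t) ![Y (ψ t), partialD (covI d k) ψ t A] := rfl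
  refine e.trans ((omega_apply A (ψ t) _ _).trans ?_)
  refine Eq.trans ?_ (congrArg Neg.neg (omega_apply A (ψ t) _ _).symm)
  ring

/-- An infinitesimal symmetry preserving the Hamiltonian is conserved, in the divergence sense, on a
dense set of parameters of every solution: the sums of the iterated Lie derivatives of `i(Y) ω^A`
along the solution vanish. -/
theorem exists_sum_iterate_lieForm_partialD_eq_zero (hHam : ContMDiff (covI d k) 𝓘(ℝ, ℝ) ∞ Ham)
    {Y : VF (covI d k) (Cov d k Q)} (hY : IsInfinitesimalSymmetry d k Ham Y)
    (hYH : lieFun (covI d k) Y Ham = 0) {D : Set (Fin k → ℝ)} {ψ : (Fin k → ℝ) → Cov d k Q}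
    (hψ : IsHDWSolution d k Ham D ψ) (hne : D.Nonempty) : ∃ t ∈ D, ∀ m : ℕ,
      ∑ A, (lieForm (covI d k) Y)^[m] (interior (covI d k) Y (omega d k A)) (ψ t)
        ![partialD (covI d k) ψ t A] = 0 := by
  obtain ⟨t, ht, hemb⟩ := exists_isEmbeddedSubmanifold_image hψ.1 hψ.2.1 hne
  refine ⟨t, ht, fun m => ?_⟩
  obtain ⟨V, b, α, hxV, hVs, hflow, hα⟩ := exists_isLocalFlow_hasDerivAt_variation hY.1 (ψ t)
  set c := extChartAt (covI d k) (ψ t) with hc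
  -- On `D'` the solution has embedded image inside the domain `V` of the flow, so the symmetry
  -- hypothesis applies to it for every `s`.
  obtain ⟨D', hD', htD', hD'N, hD'e⟩ := hemb (ψ ⁻¹' V)
    ((hψ.2.1.contMDiffAt (hψ.1.mem_nhds ht)).continuousAt.preimage_mem_nhds
      (hflow.1.mem_nhds hxV))
  have hD'D : D' ⊆ D := fun u hu => (hD'N hu).1
  have hmaps : MapsTo ψ D' V := fun u hu => (hD'N hu).2
  obtain ⟨h0, hint, hvar⟩ := hα _ hxV
  choose w hw0 hw using fun A => hvar (mfderiv (covI d k) 𝓘(ℝ, BaseE d × FibE d k) c (ψ t)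
    (partialD (covI d k) ψ t A))
  have hb : (0 : ℝ) ∈ Ioo (-b) b := ⟨neg_lt_zero.2 hflow.2.1, hflow.2.1⟩
  -- The contraction identity along the transported solution `F_s ∘ ψ` at `t`; the vectors `w A s`
  -- are its partial derivatives in the chart.
  have hzero : ∀ s ∈ Ioo (-b) b, ∑ A, Form.inChart (covI d k)
      (interior (covI d k) Y (omega d k A)) (ψ t) (α (c (ψ t)) s) ![w A s] = 0 := by
    intro s hs
    have hsol := (hY.2 V b _ hflow s hs D' ψ ⟨hψ.mono hD' hD'D, hD'e⟩ hmaps).1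
    set φ := (fun x => c.symm (α (c x) s)) ∘ ψ with hφ
    have hφt : φ t ∈ c.source := c.map_target (hint s hs).1
    have hcφ : c (φ t) = α (c (ψ t)) s := c.right_inv (hint s hs).1
    have h1 := hsol.sum_interior_omega_partialD hHam htD' Y
    rw [hYH, Pi.zero_apply, neg_zero] at h1
    rw [← h1]
    refine Finset.sum_congr rfl fun A _ => ?_
    refine Eq.trans ?_ (Form.apply_eq_inChart _ hφt _).symm
    rw [← hc, hcφ]
    refine congrArg _ ?_
    funext i
    fin_cases i
    have h2 := mfderiv_extChartAt_partialD (hsol.mdifferentiableAt htD') hφt A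
    have h3 := ((hw A s hs).2 (fun τ : ℝ => c (ψ (t + τ • Pi.single A 1))) (by simp)
      (mfderiv_extChartAt_partialD (hψ.mdifferentiableAt ht) (hVs hxV) A))
    have hev : (fun τ : ℝ => c (φ (t + τ • Pi.single A 1))) =ᶠ[𝓝 0]
        fun τ : ℝ => α (c (ψ (t + τ • Pi.single A 1))) s := by
      have hcont : Tendsto (fun τ : ℝ => t + τ • (Pi.single A 1 : Fin k → ℝ)) (𝓝 0) (𝓝 t) := by
        have : Continuous fun τ : ℝ => t + τ • (Pi.single A 1 : Fin k → ℝ) := by fun_prop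
        simpa using this.tendsto 0
      filter_upwards [hcont.eventually (hD'.mem_nhds htD')] with τ hτ
      exact c.right_inv ((hα _ (hmaps hτ)).2.1 s hs).1
    -- The variational solution and the partial derivative of `F_s ∘ ψ` are derivatives at `0` of
    -- the same curve.
    exact (h3.congr_of_eventuallyEq hev).unique h2
  -- Differentiate the identity `m` times in `s` and evaluate at `s = 0`, where the transported
  -- vectors are the original `∂_A ψ`.
  have hfin := sum_inChart_iterate_lieForm_eq_zero hY.1
    (fun A => (omega_isSmooth A).interior hY.1) isOpen_Ioo (fun s hs => (hint s hs).1)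
    (fun s hs => (hint s hs).2) (fun A s hs => (hw A s hs).1) hzero m 0 hb
  rw [← hfin]
  refine Finset.sum_congr rfl fun A _ => ?_
  refine (Form.apply_eq_inChart _ (hVs hxV) _).trans ?_
  rw [← hc, h0, hw0]
  refine congrArg _ ?_
  funext i
  fin_cases i
  rfl

/-- Integral sections of Hamiltonian `k`-vector fields are solutions of the Hamilton-de Donder-Weyl
equations. -/
theorem IsIntegralSection.isHDWSolution (hHam : ContMDiff (covI d k) 𝓘(ℝ, ℝ) ∞ Ham)
    {X : Fin k → VF (covI d k) (Cov d k Q)} (hX : IsHamiltonianKVF d k Ham X) {x : Cov d k Q}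
    {D : Set (Fin k → ℝ)} {ψ : (Fin k → ℝ) → Cov d k Q}
    (hψ : IsIntegralSection (covI d k) X x D ψ) : IsHDWSolution d k Ham D ψ := by
  refine (isHDWSolution_iff hHam).2 ⟨hψ.1, hψ.2.2.2.1, fun t ht w => ?_⟩
  have h1 := DFunLike.congr_fun (congrFun hX.2 (ψ t)) ![w]
  refine Eq.trans (show _ = dFun (covI d k) Ham (ψ t) ![w] from rfl) (h1.symm.trans ?_)
  rw [Finset.sum_apply]
  refine (ContinuousAlternatingMap.sum_apply _ _).trans ?_
  refine Finset.sum_congr rfl fun A _ => ?_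
  rw [hψ.2.2.2.2 t ht A]
  rfl

/-- Functions with differential `L(Y)^m i(Y) ω^A` form a divergence free family along solutions. -/
theorem IsHDWSolution.sum_fderiv_comp_eq_zero (hHam : ContMDiff (covI d k) 𝓘(ℝ, ℝ) ∞ Ham)
    {Y : VF (covI d k) (Cov d k Q)} (hY : IsInfinitesimalSymmetry d k Ham Y)
    (hYH : lieFun (covI d k) Y Ham = 0) {m : ℕ} {U : Set (Cov d k Q)} (hU : IsOpen U)
    {g : Fin k → Cov d k Q → ℝ} (hg : ∀ A, ContMDiffOn (covI d k) 𝓘(ℝ, ℝ) ∞ (g A) U)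
    (hdg : ∀ A, ∀ x ∈ U, (lieForm (covI d k) Y)^[m] (interior (covI d k) Y (omega d k A)) x =
      dFun (covI d k) (g A) x)
    {D : Set (Fin k → ℝ)} {ψ : (Fin k → ℝ) → Cov d k Q} (hψ : IsHDWSolution d k Ham D ψ)
    (hDU : MapsTo ψ D U) {t : Fin k → ℝ} (ht : t ∈ D) :
    ∑ A, fderiv ℝ (g A ∘ ψ) t (Pi.single A 1) = 0 := by
  have hcont : ContinuousOn (fun t => ∑ A, fderiv ℝ (g A ∘ ψ) t (Pi.single A 1)) D :=
    continuousOn_finsetSum _ fun A _ =>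
      ((((hg A).comp hψ.2.1 hDU).contDiffOn.continuousOn_fderiv_of_isOpen hψ.1
        (by simp)).clm_apply continuousOn_const)
  -- Where the continuous divergence is nonzero is an open set of parameters. The restriction of `ψ`
  -- to it is again a solution, and so has a parameter at which the divergence vanishes, a
  -- contradiction.
  by_contra hne
  obtain ⟨u, hu, huz⟩ := exists_sum_iterate_lieForm_partialD_eq_zero hHam hY hYH
    (hψ.mono (hcont.isOpen_inter_preimage hψ.1 isOpen_compl_singleton) inter_subset_left)
    ⟨t, ht, hne⟩
  refine hu.2 ((Finset.sum_congr rfl fun A _ => ?_).trans (huz m))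
  rw [fderiv_comp_eq_dFun_partialD
    (((hg A).contMDiffAt (hU.mem_nhds (hDU hu.1))).mdifferentiableAt (by simp))
    (hψ.mdifferentiableAt hu.1), hdg A _ (hDU hu.1)]

/-- The Lie derivatives of `θ^A` of order `n` are locally exact if those of `ω^A` vanish. -/
lemma IsCartanSymmetry.exists_iterate_lieForm_theta_eq_dFun {n : ℕ}
    {Y : VF (covI d k) (Cov d k Q)} (hY : IsCartanSymmetry d k Ham n Y) (A : Fin k)
    (p : Cov d k Q) : ∃ U : Set (Cov d k Q), IsOpen U ∧ p ∈ U ∧ ∃ ξ : Cov d k Q → ℝ,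
      ContMDiffOn (covI d k) 𝓘(ℝ, ℝ) ∞ ξ U ∧
        ∀ x ∈ U, (lieForm (covI d k) Y)^[n] (theta d k A) x = dFun (covI d k) ξ x := by
  have hθ := theta_isSmooth (d := d) (Q := Q) A
  refine exists_dFun_eq_of_extD_eq_zero (hθ.lieForm_iterate hY.symmetry.1 n) ?_ p
  have h1 := hY.lie_omega A
  rw [omega_eq_neg_extD, lieForm_iterate_neg hY.symmetry.1 hθ.extD, neg_eq_zero] at h1
  rw [extD_lieForm_iterate hY.symmetry.1 hθ, h1]

/-- `L(Y)^{n-1} i(Y) ω^A = d(L(Y)^{n-1} i(Y) θ^A) - L(Y)^n θ^A`. -/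
lemma iterate_lieForm_interior_omega {n : ℕ} (hn : 1 ≤ n) {Y : VF (covI d k) (Cov d k Q)}
    (hY : IsSmoothVF (covI d k) Y) (A : Fin k) :
    (lieForm (covI d k) Y)^[n - 1] (interior (covI d k) Y (omega d k A)) =
      dFun (covI d k) ((lieFun (covI d k) Y)^[n - 1] (contract (covI d k) Y (theta d k A))) -
        (lieForm (covI d k) Y)^[n] (theta d k A) := by
  have hθ := theta_isSmooth (d := d) (Q := Q) A
  have hc := hθ.contract hY
  have h1 : interior (covI d k) Y (omega d k A) =
      dFun (covI d k) (contract (covI d k) Y (theta d k A)) -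
        lieForm (covI d k) Y (theta d k A) := by
    rw [omega_eq_neg_extD, interior_neg, ← extD_interior_eq_dFun hY hθ]
    unfold lieForm
    abel
  -- Apply `L(Y)^{n-1}` to Cartan's formula; `n ≥ 1` makes the truncated `n - 1` harmless, so that
  -- `L(Y)^{n-1} L(Y) = L(Y)^n`.
  rw [h1, lieForm_iterate_sub hY (dFun_isSmooth hc) (hθ.lieForm hY), lieForm_iterate_dFun hY hc,
    ← Function.iterate_succ_apply, Nat.succ_eq_add_one, Nat.sub_add_cancel hn]

end Noether

end KSymplectic

/-! ### Noether's theorem for Cartan symmetries of order n -/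

theorem mainTheorem1 (d k : ℕ) (Q : Type*) [TopologicalSpace Q] [T2Space Q]
    [SecondCountableTopology Q] [ChartedSpace (EuclideanSpace ℝ (Fin d)) Q]
    [IsManifold (𝓡 d) ∞ Q]
    (Ham : KSymplectic.Cov d k Q → ℝ) (hHam : ContMDiff (KSymplectic.covI d k) 𝓘(ℝ, ℝ) ∞ Ham)
    (n : ℕ) (Y : KSymplectic.VF (KSymplectic.covI d k) (KSymplectic.Cov d k Q))
    (hY : KSymplectic.IsCartanSymmetry d k Ham n Y) :
    (∀ p : KSymplectic.Cov d k Q, ∃ U : Set (KSymplectic.Cov d k Q), IsOpen U ∧ p ∈ U ∧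
      ∃ ξ : Fin k → KSymplectic.Cov d k Q → ℝ,
        (∀ A, ContMDiffOn (KSymplectic.covI d k) 𝓘(ℝ, ℝ) ∞ (ξ A) U) ∧
        ∀ A, ∀ x ∈ U,
          (KSymplectic.lieForm (KSymplectic.covI d k) Y)^[n] (KSymplectic.theta d k A) x =
            KSymplectic.dFun (KSymplectic.covI d k) (ξ A) x) ∧
    ∀ (U : Set (KSymplectic.Cov d k Q)) (ξ g : Fin k → KSymplectic.Cov d k Q → ℝ), IsOpen U →
      (∀ A, ContMDiffOn (KSymplectic.covI d k) 𝓘(ℝ, ℝ) ∞ (ξ A) U) →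
      (∀ A, ∀ x ∈ U,
        (KSymplectic.lieForm (KSymplectic.covI d k) Y)^[n] (KSymplectic.theta d k A) x =
          KSymplectic.dFun (KSymplectic.covI d k) (ξ A) x) →
      (∀ A, ∀ x ∈ U, g A x =
        (KSymplectic.lieFun (KSymplectic.covI d k) Y)^[n - 1]
          (KSymplectic.contract (KSymplectic.covI d k) Y (KSymplectic.theta d k A)) x - ξ A x) →
      (∀ A, ∀ x ∈ U,
        (KSymplectic.lieForm (KSymplectic.covI d k) Y)^[n - 1]
            (KSymplectic.interior (KSymplectic.covI d k) Y (KSymplectic.omega d k A)) x =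
          KSymplectic.dFun (KSymplectic.covI d k) (g A) x) ∧
      KSymplectic.IsConservationLawOn d k Ham U g ∧
      ∀ X : Fin k → KSymplectic.VF (KSymplectic.covI d k) (KSymplectic.Cov d k Q),
        KSymplectic.IsHamiltonianKVF d k Ham X →
        KSymplectic.IsIntegrable (KSymplectic.covI d k) X →
        ∀ x ∈ U, ∑ A, KSymplectic.lieFun (KSymplectic.covI d k) (X A) (g A) x = 0 := by
  have hsm := hY.symmetry.1
  refine ⟨fun p => ?_, fun U ξ g hU hξ hξd hg => ?_⟩
  · choose W hW hpW ξ hξ hξd using fun A => hY.exists_iterate_lieForm_theta_eq_dFun A p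
    exact ⟨⋂ A, W A, isOpen_iInter_of_finite hW, mem_iInter.2 hpW, ξ,
      fun A => (hξ A).mono (iInter_subset W A), fun A x hx => hξd A x (mem_iInter.1 hx A)⟩
  have hL := fun A => KSymplectic.contMDiff_lieFun_iterate hsm
    ((KSymplectic.theta_isSmooth (Q := Q) A).contract hsm) (n - 1)
  have hgs : ∀ A, ContMDiffOn (KSymplectic.covI d k) 𝓘(ℝ, ℝ) ∞ (g A) U := fun A =>
    ((hL A).contMDiffOn.sub (hξ A)).congr (hg A)
  have hdg : ∀ A, ∀ x ∈ U,
      (KSymplectic.lieForm (KSymplectic.covI d k) Y)^[n - 1]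
          (KSymplectic.interior (KSymplectic.covI d k) Y (KSymplectic.omega d k A)) x =
        KSymplectic.dFun (KSymplectic.covI d k) (g A) x := by
    intro A x hx
    rw [KSymplectic.iterate_lieForm_interior_omega hY.order_pos hsm A, Pi.sub_apply,
      hξd A x hx]
    have h1 := (((hL A).mdifferentiableAt (x := x) (by simp)).hasMFDerivAt.sub
      (((hξ A).contMDiffAt (hU.mem_nhds hx)).mdifferentiableAt (by simp)).hasMFDerivAt)
    have h2 := h1.congr_of_eventuallyEq
      (f₁ := g A) (eventually_of_mem (hU.mem_nhds hx) (hg A))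
    ext v
    exact (DFunLike.congr_fun h2.mfderiv (v 0)).symm
  refine ⟨hdg, ⟨hgs, fun D ψ hψ hDU t ht => hψ.1.sum_fderiv_comp_eq_zero hHam hY.symmetry
    hY.lie_ham hU hgs hdg hDU ht⟩, fun X hX hint x hx => ?_⟩
  obtain ⟨D, ψ, hψ⟩ := hint x
  have hsol := hψ.isHDWSolution hHam hX
  have hsec := hψ.2.2.2.2
  obtain ⟨hD, h0, rfl, hψs, -⟩ := hψ
  -- The part of the integral section through `x` lying in `U` is an HDW solution; at parameter `0`
  -- its partial derivatives are the `X_A` at `x`, so its divergence there is `∑_A L(X_A)g^A`.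
  have hD' : IsOpen (D ∩ ψ ⁻¹' U) := hψs.continuousOn.isOpen_inter_preimage hD hU
  rw [← (hsol.mono hD' inter_subset_left).sum_fderiv_comp_eq_zero hHam hY.symmetry hY.lie_ham hU
    hgs hdg (fun u hu => hu.2) ⟨h0, hx⟩]
  refine Finset.sum_congr rfl fun A _ => ?_
  rw [KSymplectic.fderiv_comp_eq_dFun_partialD
    (((hgs A).contMDiffAt (hU.mem_nhds hx)).mdifferentiableAt (by simp))
    (hsol.mdifferentiableAt h0), hsec 0 h0 A]
  rfl
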